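/- \textbf{Setting.} Let $\beta\in(1,2)$, let $d$ be the quasi-greedy $\beta$-expansion of $1$, and let $\Xi_\beta\subset\{0,1\}^{\mathbb N}$ be the set of admissible sequences, i.e. those $x$ with $\sigma^k x\preceq d$ for all $k\ge 0$ ($\sigma$ the shift, $\preceq$ the lexicographic order). An \emph{extremal pair} is a pair $(s,t)$ of finite $0$-$1$ words with $t$ a cyclic permutation of $s$, $s^\infty\prec t^\infty$, and for every $k\ge0$ either $\sigma^k s^\infty\preceq s^\infty$ or $\sigma^k s^\infty\succeq t^\infty$. It is \emph{admissible for $\beta$} if $s^\infty\in\Xi_\beta$. An admissible extremal pair $(s,t)$ is \emph{maximal for $\beta$} if (i) there is no $x\in\Xi_\beta\setminus\{0^\infty\}$ all of whose shifts are $\prec s^\infty$, and none all of whose shifts are $\succ t^\infty$; and (ii) there is no admissible extremal pair $(\tilde s,\tilde t)$ with $\tilde s^\infty\preceq s^\infty$, $t^\infty\preceq\tilde t^\infty$ and $(\tilde s^\infty,\tilde t^\infty)\ne(s^\infty,t^\infty)$. The \emph{Farey tree} of words with roots $l$ (label $0/1$) and $r$ (label $1/1$) is built by repeatedly combining neighbouring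 words $w_1,w_2$ with labels $a/b<a'/b'$ into the word $w_2w_1$ with label $(a+a')/(b+b')$, which becomes a neighbour of both; $a/b$ is the \emph{left Farey parent} of $(a+a')/(b+b')$. For rational $\gamma\in(0,1)$ let $w_\gamma$ be the word with label $\gamma$ in the tree with roots $0$ and $1$, and $u_\gamma$ its lexicographically minimal cyclic permutation. Let $\gamma(\beta)=\sup\{\gamma\in\mathbb Q\cap(0,1): w_\gamma^\infty\in\Xi_\beta\}$. \textbf{Lemma.} Let $\gamma\in(0,1)$ be rational, not of the form $1/n$, with left Farey parent $\gamma_1$, and let $n\ge1$ be the integer with $1/(n+1)<\gamma<1/n$. For a word $w$, other than the roots, of the Farey tree with roots $0$ and $u_\gamma$, let $s$ be the lexicographically largest cyclic permutation of $w$ beginning with $0^{n+1}$, and $t$ the lexicographically smallest cyclic permutation of $w$ beginning with $0^n1$. Then for every $\beta\in(1,2)$ and every such pair $(s,t)$ with $s^\infty\in\Xi_\beta$, the pair $(s,t)$ is a maximal extremal pair for $\beta$ if and only if $\gamma(\beta)\in[\gamma_1,\gamma)$. -/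

import Mathlib

open Set

noncomputable section

namespace BetaHoles

/-! ### Words and sequences over `{0,1}` -/

/-- Finite words on the alphabet `{0,1}`. -/
abbrev Word := List (Fin 2)

/-- Infinite `0`-`1` sequences, with the lexicographic order. -/
abbrev BinSeq := Lex (ℕ → Fin 2)

/-- The shift map iterated `k` times: drop the first `k` letters. -/
def shift (k : ℕ) (x : BinSeq) : BinSeq := toLex fun i => ofLex x (i + k)

/-- The sequence `0^∞`. -/
def zeroSeq : BinSeq := toLex fun _ => 0

/-- The periodic sequence `w^∞` (used for non-empty words `w`). -/
def per (w : Word) : BinSeq := toLex fun i => w.getD (i % w.length) 0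

/-- `s = u`-`max(w)`: the lexicographically largest cyclic permutation of `w` that begins
with `u`. -/
def IsMaxRotation (u w s : Word) : Prop := IsGreatest {v : Word | v ~r w ∧ u <+: v} s

/-- `t = u`-`min(w)`: the lexicographically smallest cyclic permutation of `w` that begins
with `u`. -/
def IsMinRotation (u w t : Word) : Prop := IsLeast {v : Word | v ~r w ∧ u <+: v} t

/-! ### The `β`-transformation and admissible sequences -/

/-- `T_β x = β x mod 1`. -/
def betaMap (β x : ℝ) : ℝ := Int.fract (β * x)

/-- The greedy expansion of `1`, with digits `⌊β T_β^i 1⌋` for `i = 0, 1, …`. For `1 < β < 2`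
each of these floors is `0` or `1`. -/
def greedyOne (β : ℝ) (i : ℕ) : Fin 2 := Fin.ofNat 2 ⌊β * (betaMap β)^[i] 1⌋₊

open Classical in
/-- The quasi-greedy expansion `d` of `1`. If the greedy expansion of `1` ends in `0^∞`, and
`N` is the least number such that all digits after the first `N` vanish (so that the last
non-zero digit is the `N`-th), it is `(d̃_1 … d̃_{N-1} 0)^∞`; otherwise it is the greedy
expansion. -/
def quasiGreedyOne (β : ℝ) : BinSeq :=
  if h : ∃ N : ℕ, ∀ i, N ≤ i → greedyOne β i = 0 then
    per ((List.range (Nat.find h - 1)).map (greedyOne β) ++ [0])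
  else toLex (greedyOne β)

/-- The set `Ξ_β` of admissible sequences: those all of whose shifts are at most the
quasi-greedy expansion of `1`. -/
def admissibleSeqs (β : ℝ) : Set BinSeq := {x | ∀ k, shift k x ≤ quasiGreedyOne β}

/-! ### Extremal pairs -/

/-- `(s,t)` is an extremal pair: `t` is a cyclic permutation of `s`, `s^∞ ≺ t^∞`, and no shift of
`s^∞` lies strictly between `s^∞` and `t^∞`. -/
structure IsExtremalPair (s t : Word) : Prop where
  rotated : t ~r s
  lt : per s < per t
  gap : ∀ k, shift k (per s) ≤ per s ∨ per t ≤ shift k (per s)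

/-- `(s,t)` is a maximal extremal pair for `β`. Points of `(0,1)` are identified with
admissible sequences other than `0^∞`. -/
structure IsMaximalExtremalPair (β : ℝ) (s t : Word) : Prop where
  extremal : IsExtremalPair s t
  admissible : per s ∈ admissibleSeqs β
  /-- no orbit is contained in `[0, s^∞)` -/
  no_orbit_left : ¬ ∃ x ∈ admissibleSeqs β, x ≠ zeroSeq ∧ ∀ k, shift k x < per s
  /-- no orbit is contained in `(t^∞, 1)` -/
  no_orbit_right : ¬ ∃ x ∈ admissibleSeqs β, x ≠ zeroSeq ∧ ∀ k, per t < shift k x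
  /-- no other admissible extremal pair has a hole containing `(s^∞, t^∞)` -/
  hole_maximal : ∀ s' t' : Word, IsExtremalPair s' t' → per s' ∈ admissibleSeqs β →
    per s' ≤ per s → per t ≤ per t' → per s' = per s ∧ per t' = per t

/-! ### Farey trees -/

/-- `a/b ⊕ c/d = (a+c)/(b+d)`, for fractions in lowest terms. -/
def mediant (x y : ℚ) : ℚ := ((x.num + y.num : ℤ) : ℚ) / ((x.den + y.den : ℕ) : ℚ)

/-- `FareyNeighbours l r a u c v`: in the Farey tree of words with left root `l` (labelled `0/1`)
and right root `r` (labelled `1/1`), the words `u` and `v`, labelled by the fractions `a < c`, are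
neighbours. Two neighbours `u`, `v` are combined into the word `vu`, labelled by the mediant, which
is a neighbour of both. -/
inductive FareyNeighbours (l r : Word) : ℚ → Word → ℚ → Word → Prop
  | root : FareyNeighbours l r 0 l 1 r
  | left {a c : ℚ} {u v : Word} :
      FareyNeighbours l r a u c v → FareyNeighbours l r a u (mediant a c) (v ++ u)
  | right {a c : ℚ} {u v : Word} :
      FareyNeighbours l r a u c v → FareyNeighbours l r (mediant a c) (v ++ u) c v

/-- `w` is a non-root word, labelled by `γ`, of the Farey tree with roots `l` and `r`. -/
def IsFareyWord (l r : Word) (γ : ℚ) (w : Word) : Prop :=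
  ∃ a u c v, FareyNeighbours l r a u c v ∧ γ = mediant a c ∧ w = v ++ u

/-- `w` is the balanced word `w_γ`, for a rational `γ` in `(0,1)`. -/
def IsBalancedWord (γ : ℚ) (w : Word) : Prop := IsFareyWord [0] [1] γ w

/-- `γ₁` is the left Farey parent of `γ`. -/
def IsLeftFareyParent (γ₁ γ : ℚ) : Prop :=
  ∃ u c v, FareyNeighbours [0] [1] γ₁ u c v ∧ γ = mediant γ₁ c

/-- `u` is the minimal cyclic shift `u_γ` of the balanced word `w_γ`. -/
def IsMinBalancedWord (γ : ℚ) (u : Word) : Prop :=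
  ∃ w, IsBalancedWord γ w ∧ IsLeast {v : Word | v ~r w} u

/-- `γ(β)`, the number associated to the maximal admissible balanced word: the supremum of the
rational `γ` for which `w_γ^∞` is admissible. -/
def gammaOf (β : ℝ) : ℝ :=
  sSup {x : ℝ | ∃ (γ : ℚ) (w : Word), IsBalancedWord γ w ∧ per w ∈ admissibleSeqs β ∧ x = (γ : ℝ)}

/-- `(s,t)` is one of the pairs of the Farey tree with roots `0` and `u_γ`: with
`1/(n+1) < γ < 1/n`, it is `(0^{n+1}`-`max(w), 0^n 1`-`min(w))` for a non-root word `w`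
of that tree. -/
def IsFareyTreePair (γ : ℚ) (s t : Word) : Prop :=
  ∃ (n : ℕ) (u : Word) (δ : ℚ) (w : Word),
    1 / ((n : ℚ) + 1) < γ ∧ γ < 1 / (n : ℚ) ∧
    IsMinBalancedWord γ u ∧ IsFareyWord [0] u δ w ∧
    IsMaxRotation (List.replicate (n + 1) 0) w s ∧
    IsMinRotation (List.replicate n 0 ++ [1]) w t

end BetaHoles

end

/-!
The idea is to describe every Farey word by a closed formula and to decide all lexicographic
comparisons by prefix sums: if the prefix sums of `x` are dominated by those of `y`, strictly at
some place, then `x ≺ y` (`lt_of_ones`). The quasi-greedy expansion `d` enters only as an upper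
bound for sequences; nothing about its digits is needed.

The word `w_γ`, with `γ = p/q` in lowest terms, repeats to the mechanical sequence whose prefix sums
are `⌈iγ⌉`, and `u_γ` to the one with prefix sums `⌊iγ⌋` (`FareyNeighbours.isUpperWord`,
`IsMinBalancedWord.isLowerWord`). Hence `w_γ^∞` is the largest of its shifts, it is admissible iff
`w_γ^∞ ⪯ d`, and `u_γ` is a Lyndon word. Moreover `γ(β) < γ` iff `d ≺ w_γ^∞`: since `⌈jγ⌉` is
left-continuous in `γ`, a sequence `d ≺ w_γ^∞` is also smaller than `w_γ'^∞` for `γ'` slightly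
below `γ` (`gammaOf_lt`).

The words of the Farey tree with roots `0` and `u = u_γ` are the images of balanced words of some
slope `P/Q` under the order-preserving substitution `0 ↦ 0`, `1 ↦ u`, and the hole `(s^∞, t^∞)` is
cut out by two consecutive elements of the orbit, one the image of a sequence beginning with `0`,
the other one beginning with `u`.

* If `s^∞` is admissible, then `γ₁ ≤ γ(β)`: the suffix of `u` whose length is the denominator of
  `γ₁` already exceeds the corresponding prefix of `w_γ₁^∞` (`IsTreePair.exists_lt_shift`).
* Condition (ii) on other holes holds for every `β`. If the hole of `(s',t')` contains that of
  `(s,t)`, then `s'^∞` splits into blocks `0` and `u` (`IsTreePair.exists_eq_subst`), hence is the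
  image of a sequence avoiding the hole of slope `P/Q`. Comparing densities of ones, such a sequence
  has a tail in the orbit of slope `P/Q` (`exists_shift_eq_mech`).
* No orbit is below `s^∞`, which begins with `0`. If `d ≺ w_γ^∞`, then no admissible orbit is above
  `t^∞`, as its tails would lie between `u 0^∞` and `w_γ^∞`, which is impossible, again by densities
  (`IsLowerWord.not_forall_shift_between`). If `w_γ^∞ ⪯ d`, then the orbit of `w_γ^∞` is admissible
  and lies above `t^∞` (`IsTreePair.per_t_lt`).
-/

namespace BetaHoles

/-! ### Letters, order and shifts -/

theorem fin2_cases (a : Fin 2) : a = 0 ∨ a = 1 := by omega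

theorem fin2_val_le (a : Fin 2) : a.val ≤ 1 := by omega

theorem fin2_lt_iff (a b : Fin 2) : a < b ↔ a = 0 ∧ b = 1 := by omega

theorem lt_iff_exists {x y : BinSeq} :
    x < y ↔ ∃ i, (∀ j < i, ofLex x j = ofLex y j) ∧ ofLex x i = 0 ∧ ofLex y i = 1 := by
  have : x < y ↔ ∃ i, (∀ j < i, ofLex x j = ofLex y j) ∧ ofLex x i < ofLex y i := Iff.rfl
  simp only [this, fin2_lt_iff]

theorem seq_ext {x y : BinSeq} (h : ∀ i, ofLex x i = ofLex y i) : x = y := funext h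

theorem ofLex_shift (k : ℕ) (x : BinSeq) (i : ℕ) :
    ofLex (shift k x) i = ofLex x (i + k) := rfl

@[simp] theorem shift_zero (x : BinSeq) : shift 0 x = x := rfl

theorem shift_shift (j k : ℕ) (x : BinSeq) : shift j (shift k x) = shift (k + j) x :=
  seq_ext fun i => by rw [ofLex_shift, ofLex_shift, ofLex_shift, Nat.add_assoc, Nat.add_comm j k]

/-! ### Prefix sums -/

/-- The number of letters `1` among the first `N` letters of `x`. -/
def ones (x : BinSeq) (N : ℕ) : ℕ := ∑ i ∈ Finset.range N, (ofLex x i).val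

@[simp] theorem ones_zero (x : BinSeq) : ones x 0 = 0 := rfl

theorem ones_succ (x : BinSeq) (N : ℕ) : ones x (N + 1) = ones x N + (ofLex x N).val :=
  Finset.sum_range_succ _ _

theorem ones_add (x : BinSeq) (k N : ℕ) : ones x (k + N) = ones x k + ones (shift k x) N := by
  simp only [ones, Finset.sum_range_add, ofLex_shift, Nat.add_comm]

theorem ones_congr {x y : BinSeq} {N : ℕ} (h : ∀ i < N, ofLex x i = ofLex y i) :
    ones x N = ones y N :=
  Finset.sum_congr rfl fun i hi => by rw [h i (Finset.mem_range.1 hi)]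

/-- A sequence whose prefix sums dominate those of another one, strictly at some place, is
lexicographically larger, whatever comes after that place. -/
theorem lt_of_ones {x y : BinSeq} {N : ℕ} (h : ∀ i ≤ N, ones x i ≤ ones y i)
    (hN : ones x N < ones y N) : x < y := by
  classical
  have hex : ∃ i, ones x i ≠ ones y i := ⟨N, hN.ne⟩
  obtain ⟨j, hj⟩ : ∃ j, Nat.find hex = j + 1 := by
    refine Nat.exists_eq_succ_of_ne_zero fun h0 => ?_
    exact Nat.find_spec hex (by simp [h0])
  have hne : ones x (j + 1) ≠ ones y (j + 1) := hj ▸ Nat.find_spec hex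
  have heq : ∀ i ≤ j, ones x i = ones y i := fun i hi =>
    not_not.1 (Nat.find_min hex (by omega : i < Nat.find hex))
  have hjN : j + 1 ≤ N := hj ▸ Nat.find_min' hex hN.ne
  have hle := h _ hjN
  refine lt_iff_exists.2 ⟨j, fun i hi => ?_, ?_⟩
  · have h1 := heq i hi.le
    have h2 := heq (i + 1) hi
    rw [ones_succ, ones_succ] at h2
    exact Fin.ext (by omega)
  · have h1 := heq j le_rfl
    rw [ones_succ, ones_succ] at hle hne
    omega

theorem le_of_ones {x y : BinSeq} (h : ∀ i, ones x i ≤ ones y i) : x ≤ y := by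
  by_contra! hlt
  obtain ⟨i, hi, hy, hx⟩ := lt_iff_exists.1 hlt
  have h1 := ones_congr hi
  have h2 := h (i + 1)
  rw [ones_succ, ones_succ, h1, hx, hy] at h2
  simp at h2

/-! ### Prefixing a word to a sequence -/

/-- The sequence `v z`. -/
def pre (v : Word) (z : BinSeq) : BinSeq :=
  toLex fun i => if i < v.length then v.getD i 0 else ofLex z (i - v.length)

theorem ofLex_pre (v : Word) (z : BinSeq) (i : ℕ) :
    ofLex (pre v z) i = if i < v.length then v.getD i 0 else ofLex z (i - v.length) := rfl

theorem ofLex_pre_of_lt {v : Word} {i : ℕ} (h : i < v.length) (z : BinSeq) :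
    ofLex (pre v z) i = v.getD i 0 := if_pos h

@[simp] theorem shift_length_pre (v : Word) (z : BinSeq) : shift v.length (pre v z) = z :=
  seq_ext fun i => by
    rw [ofLex_shift, ofLex_pre, if_neg (by omega), Nat.add_sub_cancel]

theorem shift_pre {v : Word} {k : ℕ} (h : v.length ≤ k) (z : BinSeq) :
    shift k (pre v z) = shift (k - v.length) z := by
  conv_lhs => rw [← Nat.add_sub_cancel' h, ← shift_shift, shift_length_pre]

theorem pre_append (v w : Word) (z : BinSeq) : pre (v ++ w) z = pre v (pre w z) := by
  refine seq_ext fun i => ?_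
  simp only [ofLex_pre, List.length_append]
  by_cases h1 : i < v.length
  · rw [if_pos h1, if_pos (by omega), List.getD_append _ _ _ _ h1]
  · rw [if_neg h1]
    by_cases h2 : i < v.length + w.length
    · rw [if_pos h2, if_pos (by omega), List.getD_append_right _ _ _ _ (by omega)]
    · rw [if_neg h2, if_neg (by omega), Nat.sub_sub]

theorem pre_lt_pre {v : Word} {y z : BinSeq} (h : y < z) : pre v y < pre v z := by
  obtain ⟨i, hi, h0, h1⟩ := lt_iff_exists.1 h
  refine lt_iff_exists.2 ⟨i + v.length, fun j hj => ?_, ?_, ?_⟩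
  · simp only [ofLex_pre]
    split_ifs
    · rfl
    · exact hi _ (by omega)
  all_goals rwa [ofLex_pre, if_neg (by omega), Nat.add_sub_cancel]

theorem pre_le_pre {v : Word} {y z : BinSeq} (h : y ≤ z) : pre v y ≤ pre v z := by
  rcases h.eq_or_lt with rfl | h
  exacts [le_rfl, (pre_lt_pre h).le]

theorem le_of_pre_le_pre {v : Word} {y z : BinSeq} (h : pre v y ≤ pre v z) : y ≤ z :=
  not_lt.1 fun hlt => (pre_lt_pre hlt).not_ge h

theorem eq_pre_shift {v : Word} {x : BinSeq} (h : ∀ i < v.length, ofLex x i = v.getD i 0) :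
    x = pre v (shift v.length x) := by
  refine seq_ext fun i => ?_
  rw [ofLex_pre]
  split_ifs with hi
  · exact h i hi
  · rw [ofLex_shift, Nat.sub_add_cancel (not_lt.1 hi)]

theorem eq_pre_of_le_of_le {v : Word} {a b x : BinSeq} (ha : pre v a ≤ x) (hb : x ≤ pre v b) :
    x = pre v (shift v.length x) := by
  refine eq_pre_shift fun i => ?_
  induction i using Nat.strong_induction_on with
  | _ i ih =>
    intro hi
    by_contra hne
    have hag : ∀ z, ∀ j < i, ofLex x j = ofLex (pre v z) j := fun z j hj => by
      rw [ofLex_pre_of_lt (hj.trans hi)]; exact ih j hj (hj.trans hi)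
    rcases fin2_cases (ofLex x i) with h0 | h1
    · refine ha.not_gt (lt_iff_exists.2 ⟨i, hag a, h0, ?_⟩)
      rw [ofLex_pre_of_lt hi]; omega
    · refine hb.not_gt (lt_iff_exists.2 ⟨i, fun j hj => (hag b j hj).symm, ?_, h1⟩)
      rw [ofLex_pre_of_lt hi]; omega

/-! ### Periodic sequences -/

theorem ofLex_per (w : Word) (i : ℕ) : ofLex (per w) i = w.getD (i % w.length) 0 := rfl

theorem per_nil : per [] = zeroSeq := rfl

theorem pre_per {w : Word} (hw : w ≠ []) : pre w (per w) = per w := by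
  refine seq_ext fun i => ?_
  have := List.length_pos_iff.2 hw
  rw [ofLex_pre, ofLex_per, ofLex_per]
  split_ifs with h
  · rw [Nat.mod_eq_of_lt h]
  · rw [Nat.mod_eq_sub_mod (by omega : w.length ≤ i)]

theorem eq_per_of_pre_eq {w : Word} (hw : w ≠ []) {z : BinSeq} (h : pre w z = z) : z = per w := by
  refine seq_ext fun i => ?_
  have hpos := List.length_pos_iff.2 hw
  induction i using Nat.strong_induction_on with
  | _ i ih =>
    rw [← h, ← pre_per hw, ofLex_pre, ofLex_pre]
    split_ifs with hi
    · rfl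
    · exact ih _ (by omega)

theorem shift_mul_length_per (w : Word) (m : ℕ) : shift (m * w.length) (per w) = per w :=
  seq_ext fun i => by rw [ofLex_shift, ofLex_per, ofLex_per, Nat.add_mul_mod_self_right]

theorem per_rotate (w : Word) (k : ℕ) : per (w.rotate k) = shift k (per w) := by
  rcases eq_or_ne w [] with rfl | hw
  · simp only [List.rotate_nil, per_nil]; rfl
  refine seq_ext fun i => ?_
  have hpos := List.length_pos_iff.2 hw
  have h1 : i % w.length < (w.rotate k).length := by simpa using Nat.mod_lt _ hpos
  rw [ofLex_shift, ofLex_per, ofLex_per, List.length_rotate, List.getD_eq_getElem _ _ h1,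
    List.getElem_rotate, List.getD_eq_getElem _ _ (Nat.mod_lt _ hpos)]
  simp

theorem exists_shift_of_isRotated {v w : Word} (h : v ~r w) : ∃ k, per v = shift k (per w) := by
  obtain ⟨k, hk⟩ := h.symm
  exact ⟨k, by rw [← hk, per_rotate]⟩

theorem per_le_per {v w : Word} (hl : v.length = w.length) (h : v ≤ w) : per v ≤ per w := by
  rcases h.eq_or_lt with rfl | h
  · rfl
  rcases List.lt_iff_exists.1 h with h | ⟨i, h₁, h₂, hag, hi⟩
  · omega
  · rw [fin2_lt_iff] at hi
    refine (lt_iff_exists.2 ⟨i, fun j hj => ?_, ?_, ?_⟩).le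
    · rw [ofLex_per, ofLex_per, Nat.mod_eq_of_lt (by omega), Nat.mod_eq_of_lt (by omega),
        List.getD_eq_getElem _ _ (by omega), List.getD_eq_getElem _ _ (by omega)]
      exact hag j hj
    · rw [ofLex_per, Nat.mod_eq_of_lt h₁, List.getD_eq_getElem _ _ h₁, hi.1]
    · rw [ofLex_per, Nat.mod_eq_of_lt h₂, List.getD_eq_getElem _ _ h₂, hi.2]

/-- A tail of a periodic sequence has the whole sequence as a tail. -/
theorem per_eq_shift_of_shift_eq {w : Word} {z : BinSeq} {k : ℕ} (h : shift k (per w) = z) :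
    ∃ j, per w = shift j z := by
  rcases eq_or_ne w [] with rfl | hw
  · exact ⟨0, by rw [← h, per_nil]; rfl⟩
  have hpos := List.length_pos_iff.2 hw
  refine ⟨k * w.length - k, ?_⟩
  rw [← h, shift_shift, Nat.add_sub_cancel' (Nat.le_mul_of_pos_right _ hpos), shift_mul_length_per]

theorem getD_of_prefix {a v : Word} (h : a <+: v) {i : ℕ} (hi : i < a.length) :
    ofLex (per v) i = a.getD i 0 := by
  obtain ⟨b, rfl⟩ := h
  rw [ofLex_per, Nat.mod_eq_of_lt (by simp; omega), List.getD_append _ _ _ _ hi]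

theorem prefix_of_ofLex_per {a v : Word} (hl : a.length ≤ v.length)
    (h : ∀ i < a.length, ofLex (per v) i = a.getD i 0) : a <+: v := by
  rw [List.prefix_iff_eq_take]
  refine List.ext_getElem (by simp [hl]) fun i h₁ h₂ => ?_
  have := h i h₁
  rw [ofLex_per, Nat.mod_eq_of_lt (by omega), List.getD_eq_getElem _ _ (by omega),
    List.getD_eq_getElem _ _ h₁] at this
  simp [this]

/-- `s^∞` is the largest among the shifts of `w^∞` that begin with `a`. -/
theorem IsMaxRotation.shift_le {a w s : Word} (h : IsMaxRotation a w s) {k : ℕ}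
    (hk : ∀ i < a.length, ofLex (shift k (per w)) i = a.getD i 0) :
    shift k (per w) ≤ per s := by
  have hls := h.1.1.perm.length_eq
  have hl : a.length ≤ w.length := by rw [← hls]; exact h.1.2.length_le
  rw [← per_rotate] at hk ⊢
  refine per_le_per (by simp [hls]) (h.2 ⟨List.IsRotated.forall w k, ?_⟩)
  exact prefix_of_ofLex_per (by simpa using hl) hk

/-- `t^∞` is the least among the shifts of `w^∞` that begin with `a`. -/
theorem IsMinRotation.le_shift {a w t : Word} (h : IsMinRotation a w t) {k : ℕ}
    (hk : ∀ i < a.length, ofLex (shift k (per w)) i = a.getD i 0) :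
    per t ≤ shift k (per w) := by
  have hls := h.1.1.perm.length_eq
  have hl : a.length ≤ w.length := by rw [← hls]; exact h.1.2.length_le
  rw [← per_rotate] at hk ⊢
  refine per_le_per (by simp [hls]) (h.2 ⟨List.IsRotated.forall w k, ?_⟩)
  exact prefix_of_ofLex_per (by simpa using hl) hk

/-! ### Mechanical sequences -/

/-- The mechanical (Sturmian, here periodic) sequence of slope `p/q` and intercept `c/q`: its
`i`-th letter is `⌊((i+1)p+c)/q⌋ - ⌊(ip+c)/q⌋`, for `p ≤ q`. For coprime `p`, `q` the sequences
with `c < q` form one orbit of the shift, that of the balanced word of slope `p/q`; `c = q - 1` is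
the largest sequence in the orbit and `c = 0` the least. -/
def mech (p q c : ℕ) : BinSeq :=
  toLex fun i => if (i * p + c) / q < ((i + 1) * p + c) / q then 1 else 0

theorem mech_eq_one_iff {p q c i : ℕ} :
    ofLex (mech p q c) i = 1 ↔ (i * p + c) / q < ((i + 1) * p + c) / q := by
  change (if _ then (1 : Fin 2) else 0) = 1 ↔ _
  split_ifs with h <;> simp [h]

theorem mech_eq_zero_iff {p q c i : ℕ} :
    ofLex (mech p q c) i = 0 ↔ ((i + 1) * p + c) / q ≤ (i * p + c) / q := by
  change (if _ then (1 : Fin 2) else 0) = 0 ↔ _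
  split_ifs with h
  · simp; omega
  · simp; omega

theorem ones_mech {p q c : ℕ} (hpq : p ≤ q) (hc : c < q) (N : ℕ) :
    ones (mech p q c) N = (N * p + c) / q := by
  induction N with
  | zero => simp [Nat.div_eq_of_lt hc]
  | succ N ih =>
    have h1 : (N * p + c) / q ≤ ((N + 1) * p + c) / q :=
      Nat.div_le_div_right (by nlinarith)
    have h2 : ((N + 1) * p + c) / q ≤ (N * p + c) / q + 1 := by
      rw [← Nat.add_div_right _ (by omega : 0 < q)]
      exact Nat.div_le_div_right (by nlinarith)
    rw [ones_succ, ih]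
    rcases fin2_cases (ofLex (mech p q c) N) with h | h
    · have := mech_eq_zero_iff.1 h
      rw [h]; simp; omega
    · have := mech_eq_one_iff.1 h
      rw [h]; simp; omega

theorem shift_mech {p q c : ℕ} (hq : 0 < q) (k : ℕ) :
    shift k (mech p q c) = mech p q ((c + k * p) % q) := by
  refine seq_ext fun i => ?_
  have key : ∀ j, ((j + k) * p + c) / q = (j * p + (c + k * p) % q) / q + (c + k * p) / q := by
    intro j
    rw [← Nat.add_mul_div_left _ _ hq]
    congr 1
    have := Nat.mod_add_div (c + k * p) q
    linarith
  have h1 := key i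
  have h2 := key (i + 1)
  have h3 : i + k + 1 = i + 1 + k := by omega
  rw [ofLex_shift]
  rcases fin2_cases (ofLex (mech p q ((c + k * p) % q)) i) with h | h
  · rw [h, mech_eq_zero_iff, h3]
    have := mech_eq_zero_iff.1 h
    omega
  · rw [h, mech_eq_one_iff, h3]
    have := mech_eq_one_iff.1 h
    omega

theorem mech_mono {p q c c' : ℕ} (hpq : p ≤ q) (h : c ≤ c') (hc : c' < q) :
    mech p q c ≤ mech p q c' := by
  refine le_of_ones fun i => ?_
  rw [ones_mech hpq (by omega), ones_mech hpq hc]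
  exact Nat.div_le_div_right (by omega)

theorem mech_head_eq_one_iff {p q c : ℕ} (hc : c < q) :
    ofLex (mech p q c) 0 = 1 ↔ q ≤ p + c := by
  rw [mech_eq_one_iff]
  simp only [zero_mul, zero_add, one_mul, Nat.div_eq_of_lt hc, Nat.div_pos_iff]
  omega

theorem exists_shift_mech {p q c c' : ℕ} (hcop : p.Coprime q) (hc' : c' < q) (hc : c < q) :
    ∃ k, shift k (mech p q c) = mech p q c' := by
  have hq : 0 < q := by omega
  obtain ⟨m, hm⟩ : ∃ m, p * m ≡ 1 [MOD q] := by
    rcases Nat.lt_or_ge 1 q with h1 | h1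
    · obtain ⟨m, hm⟩ := Nat.exists_mul_mod_eq_one_of_coprime hcop h1
      exact ⟨m, by rw [Nat.ModEq, hm.2, Nat.mod_eq_of_lt h1]⟩
    · obtain rfl : q = 1 := by omega
      exact ⟨0, Nat.modEq_one⟩
  refine ⟨m * (c' + (q - c)), ?_⟩
  rw [shift_mech hq]
  congr 1
  have h1 : c + m * (c' + (q - c)) * p ≡ c + 1 * (c' + (q - c)) [MOD q] := by
    refine Nat.ModEq.add_left _ ?_
    calc m * (c' + (q - c)) * p = p * m * (c' + (q - c)) := by ring
      _ ≡ 1 * (c' + (q - c)) [MOD q] := hm.mul_right _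
  have h2 : c + 1 * (c' + (q - c)) = c' + q := by omega
  rw [h2] at h1
  have h3 : (c + m * (c' + (q - c)) * p) % q = (c' + q) % q := h1
  rw [h3, Nat.add_mod_right, Nat.mod_eq_of_lt hc']

/-! ### The lower Christoffel word -/

/-- `u` is one period of the least sequence `mech p q 0` of its orbit. -/
structure IsLowerWord (p q : ℕ) (u : Word) : Prop where
  pos : 0 < p
  lt : p < q
  coprime : p.Coprime q
  length : u.length = q
  per_eq : per u = mech p q 0

namespace IsLowerWord

variable {p q : ℕ} {u : Word}

theorem ne_nil (hu : IsLowerWord p q u) : u ≠ [] := by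
  rintro rfl
  have h1 := hu.length
  have h2 := hu.lt
  simp at h1
  omega

theorem getD_eq (hu : IsLowerWord p q u) {i : ℕ} (hi : i < q) :
    u.getD i 0 = ofLex (mech p q 0) i := by
  rw [← hu.per_eq, ofLex_per, hu.length, Nat.mod_eq_of_lt hi]

theorem ones_pre (hu : IsLowerWord p q u) (z : BinSeq) {i : ℕ} (hi : i ≤ q) :
    ones (pre u z) i = i * p / q := by
  have h := ones_mech hu.lt.le (pos_of_gt hu.lt) i
  rw [add_zero] at h
  rw [← h]
  refine ones_congr fun j hj => ?_
  rw [ofLex_pre_of_lt (by rw [hu.length]; omega), hu.getD_eq (by omega)]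

theorem ones_shift_pre (hu : IsLowerWord p q u) (z : BinSeq) {i k : ℕ} (hi : i + k ≤ q) :
    ones (shift k (pre u z)) i = (i * p + k * p % q) / q := by
  have hq : 0 < q := pos_of_gt hu.lt
  rw [← ones_mech hu.lt.le (Nat.mod_lt _ hq)]
  have h := shift_mech (p := p) (q := q) (c := 0) hq k
  rw [zero_add] at h
  rw [← h]
  refine ones_congr fun j hj => ?_
  rw [ofLex_shift, ofLex_shift, ofLex_pre_of_lt (by rw [hu.length]; omega), hu.getD_eq (by omega)]

/-- `u` is a Lyndon word: each proper suffix exceeds it, before the suffix ends. -/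
theorem pre_lt_shift_pre (hu : IsLowerWord p q u) {k : ℕ} (hk : 0 < k) (hkq : k < q)
    (y z : BinSeq) : pre u y < shift k (pre u z) := by
  have hq : 0 < q := pos_of_gt hu.lt
  refine lt_of_ones (N := q - k) (fun i hi => ?_) ?_
  · rw [hu.ones_pre _ (by omega), hu.ones_shift_pre _ (by omega)]
    exact Nat.div_le_div_right (by omega)
  · rw [hu.ones_pre _ (by omega), hu.ones_shift_pre _ (by omega)]
    have hr : 0 < k * p % q := by
      refine Nat.pos_of_ne_zero fun h0 => ?_
      have hdvd : q ∣ k := (hu.coprime.symm).dvd_of_dvd_mul_right (Nat.dvd_of_mod_eq_zero h0)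
      exact absurd (Nat.le_of_dvd hk hdvd) (by omega)
    have hdm := Nat.mod_add_div (k * p) q
    have hap : k * p / q ≤ p := by
      refine Nat.div_le_of_le_mul ?_
      exact Nat.mul_le_mul_right _ hkq.le
    obtain ⟨b, hb⟩ := Nat.exists_eq_add_of_le hap
    obtain ⟨e, he⟩ := Nat.exists_eq_add_of_le hkq.le
    have hsum : (q - k) * p + k * p % q = q * b := by
      have h1 : q - k = e := by omega
      have h2 : q * p = k * p + e * p := by rw [← Nat.add_mul, ← he]
      have h3 : q * p = q * (k * p / q) + q * b := by rw [← Nat.mul_add, ← hb]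
      rw [h1]; omega
    rw [hsum, Nat.mul_div_cancel_left _ hq, Nat.div_lt_iff_lt_mul hq, Nat.mul_comm b q]
    omega

/-- For a slope between `1/(n+1)` and `1/n`, the word `u` begins with `0^n 1`. -/
theorem getD_of_slope (hu : IsLowerWord p q u) {n : ℕ} (h1 : q < (n + 1) * p) (h2 : n * p < q) :
    (∀ i < n, u.getD i 0 = 0) ∧ u.getD n 0 = 1 ∧ n < q := by
  have hpos := hu.pos
  have hn : n < q := by nlinarith
  refine ⟨fun i hi => ?_, ?_, hn⟩
  · rw [hu.getD_eq (by omega), mech_eq_zero_iff]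
    have : (i + 1) * p ≤ n * p := Nat.mul_le_mul_right _ hi
    rw [Nat.div_eq_of_lt (by omega)]
    exact Nat.zero_le _
  · rw [hu.getD_eq hn, mech_eq_one_iff, add_zero, add_zero, Nat.div_eq_of_lt h2]
    exact Nat.div_pos h1.le (by omega)

end IsLowerWord

/-! ### Growth of prefix sums along an orbit -/

/-- The excess `q · #1 - p · N` of the first `N` letters over the slope `p/q`. -/
def excess (p q : ℕ) (x : BinSeq) (N : ℕ) : ℤ := q * ones x N - p * N

theorem excess_add (p q : ℕ) (x : BinSeq) (k i : ℕ) :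
    excess p q x (k + i) = excess p q x k + (q * ones (shift k x) i - p * i) := by
  simp only [excess, ones_add]; push_cast; ring

/-- If from each restart place `k` the function `h` either stays above `h k - C` or meets a later
restart place at which it is not smaller, it never falls below `h k - C`. -/
theorem sub_le_of_step {h : ℕ → ℤ} {R : ℕ → Prop} {C : ℤ}
    (step : ∀ k, R k → ∀ N, k ≤ N →
      h k - C ≤ h N ∨ ∃ k', R k' ∧ k < k' ∧ k' ≤ N ∧ h k ≤ h k') :
    ∀ N k, R k → k ≤ N → h k - C ≤ h N := by
  intro N k hk hkN
  induction hd : N - k using Nat.strong_induction_on generalizing k with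
  | _ d ih =>
    rcases step k hk N hkN with h' | ⟨k', hR, hlt, hle, hh⟩
    · exact h'
    · have := ih (N - k') (by omega) k' hR hle rfl
      omega

theorem exists_add_le_of_step {h : ℕ → ℤ} {R : ℕ → Prop}
    (step : ∀ k, R k → ∃ k', R k' ∧ h k + 1 ≤ h k') {k₀ : ℕ} (hk₀ : R k₀) (m : ℕ) :
    ∃ k, R k ∧ h k₀ + m ≤ h k := by
  induction m with
  | zero => exact ⟨k₀, hk₀, by simp⟩
  | succ m ih =>
    obtain ⟨k, hk, hh⟩ := ih
    obtain ⟨k', hk', hh'⟩ := step k hk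
    exact ⟨k', hk', by push_cast; omega⟩

/-- The orbits in the complement of the hole between the two consecutive elements
`mech p q (q - p - 1)` and `mech p q (q - p)` of the orbit of slope `p/q`. Whenever a tail that
begins with `1` differs from `mech p q (q - p)`, the letters before the difference have density
of ones above `p/q`; so the excess would be unbounded if no tail were equal to that sequence. In
the same way the tails that begin with `0` bound the excess from above. -/
theorem exists_shift_eq_mech {p q : ℕ} (hpq : p < q) {y : BinSeq}
    (h1 : ∀ k, ofLex y k = 1 → mech p q (q - p) ≤ shift k y)
    (h0 : ∀ k, ofLex y k = 0 → shift k y ≤ mech p q (q - p - 1))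
    {k₀ k₁ : ℕ} (hk₀ : ofLex y k₀ = 0) (hk₁ : ofLex y k₁ = 1) (hp : 0 < p) :
    ∃ k, shift k y = mech p q (q - p) := by
  by_contra! hne
  have hup : ∀ N k, ofLex y k = 0 → k ≤ N → -excess p q y k - q ≤ -excess p q y N := by
    refine sub_le_of_step fun k hk N hkN => ?_
    have hones := fun i => ones_mech (p := p) (q := q) (c := q - p - 1) hpq.le (by omega) i
    -- agreement with the upper end of the hole up to `N` keeps the excess within `q`
    have hagree : (∀ i < N - k, ofLex (shift k y) i = ofLex (mech p q (q - p - 1)) i) →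
        -excess p q y k - q ≤ -excess p q y N := by
      intro hag
      have hN := excess_add p q y k (N - k)
      rw [Nat.add_sub_cancel' hkN, ones_congr hag, hones] at hN
      have hd := Nat.mul_div_le ((N - k) * p + (q - p - 1)) q
      have hd' : (q : ℤ) * (((N - k) * p + (q - p - 1)) / q : ℕ) ≤ (N - k : ℕ) * p + q := by
        have : q * (((N - k) * p + (q - p - 1)) / q) ≤ (N - k) * p + q := by omega
        exact_mod_cast this
      have : (p : ℤ) * (N - k : ℕ) = (N - k : ℕ) * p := mul_comm _ _
      omega
    rcases (h0 k hk).eq_or_lt with heq | hlt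
    · exact Or.inl (hagree fun i _ => by rw [heq])
    obtain ⟨i, hag, hy, hm⟩ := lt_iff_exists.1 hlt
    rcases le_or_gt (N - k) i with hi | hi
    · exact Or.inl (hagree fun j hj => hag j (by omega))
    refine Or.inr ⟨k + i, by rw [← hy, ofLex_shift, Nat.add_comm], ?_, by omega, ?_⟩
    · rcases Nat.eq_zero_or_pos i with rfl | hi0
      · rw [mech_head_eq_one_iff (by omega)] at hm
        omega
      · omega
    · have hN := excess_add p q y k i
      rw [ones_congr hag, hones] at hN
      rw [mech_eq_one_iff] at hm
      have e1 : (i + 1) * p + (q - p - 1) = i * p + (q - 1) := by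
        rw [Nat.add_mul]; omega
      rw [e1] at hm
      have hd := Nat.mul_div_le (i * p + (q - 1)) q
      have hd2 : q * ((i * p + (q - p - 1)) / q + 1) ≤ q * ((i * p + (q - 1)) / q) :=
        Nat.mul_le_mul_left _ hm
      rw [Nat.mul_add] at hd2
      have hd' : (q : ℤ) * ((i * p + (q - p - 1)) / q : ℕ) ≤ p * i := by
        have : q * ((i * p + (q - p - 1)) / q) ≤ p * i := by rw [Nat.mul_comm p i]; omega
        exact_mod_cast this
      omega
  have hesc : ∀ k, ofLex y k = 1 → ∃ k', ofLex y k' = 1 ∧ excess p q y k + 1 ≤ excess p q y k' := by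
    intro k hk
    obtain ⟨i, hag, hm, hy⟩ := lt_iff_exists.1 (lt_of_le_of_ne (h1 k hk) (hne k).symm)
    refine ⟨k + i, by rw [← hy, ofLex_shift, Nat.add_comm], ?_⟩
    have hN := excess_add p q y k i
    rw [← ones_congr hag, ones_mech hpq.le (by omega)] at hN
    rw [mech_eq_zero_iff] at hm
    have e1 : (i + 1) * p + (q - p) = i * p + q := by
      rw [Nat.add_mul]; omega
    rw [e1] at hm
    have hd := Nat.lt_mul_div_succ (i * p + q) (by omega : 0 < q)
    have hd2 := Nat.mul_le_mul_left q hm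
    rw [Nat.mul_add] at hd
    have hd' : (p : ℤ) * i < (q : ℤ) * ((i * p + (q - p)) / q : ℕ) := by
      have : p * i < q * ((i * p + (q - p)) / q) := by rw [Nat.mul_comm p i]; omega
      exact_mod_cast this
    omega
  obtain ⟨k, hk, hbig⟩ := exists_add_le_of_step hesc hk₁
    ((excess p q y k₀ - excess p q y k₁ + q).toNat + (q * k₀ - excess p q y k₁).toNat + 1)
  rcases le_or_gt k₀ k with hle | hlt
  · have := hup k k₀ hk₀ hle
    push_cast at hbig
    omega
  · have hle : ones y k ≤ k₀ := by
      calc ones y k ≤ ∑ _i ∈ Finset.range k, 1 := Finset.sum_le_sum fun i _ => fin2_val_le _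
        _ = k := by simp
        _ ≤ k₀ := hlt.le
    have hle' : (q : ℤ) * ones y k ≤ q * k₀ := by exact_mod_cast Nat.mul_le_mul_left q hle
    have : excess p q y k ≤ q * k₀ := by
      have : (0 : ℤ) ≤ p * k := by positivity
      simp only [excess]; omega
    push_cast at hbig
    omega

/-- No orbit lies between `u 0^∞` and the largest shift of `u^∞`, the latter excluded: the lower
bound keeps the excess bounded from below, the upper bound makes it decrease forever. -/
theorem IsLowerWord.not_forall_shift_between {p q : ℕ} {u : Word} (hu : IsLowerWord p q u)
    {x : BinSeq} (hlow : ∀ k, pre u zeroSeq ≤ shift k x)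
    (hup : ∀ k, shift k x < mech p q (q - 1)) : False := by
  have hq : 0 < q := pos_of_gt hu.lt
  have hbelow : ∀ N k, True → k ≤ N → excess p q x k - q ≤ excess p q x N := by
    refine sub_le_of_step fun k _ N hkN => ?_
    -- `i` letters in common with `u`
    have hagree : ∀ i, i ≤ q → (∀ j < i, ofLex (shift k x) j = ofLex (pre u zeroSeq) j) →
        ∀ j ≤ i, excess p q x k - q ≤ excess p q x (k + j) := by
      intro i hi hag j hj
      have hN := excess_add p q x k j
      rw [ones_congr fun l hl => hag l (hl.trans_le hj), hu.ones_pre _ (hj.trans hi)] at hN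
      have hd := Nat.lt_mul_div_succ (j * p) hq
      rw [Nat.mul_add] at hd
      have hd' : (p : ℤ) * j < q * (j * p / q : ℕ) + q := by
        have : p * j < q * (j * p / q) + q := by rw [Nat.mul_comm p j]; omega
        exact_mod_cast this
      omega
    have hblock : (∀ j < q, ofLex (shift k x) j = ofLex (pre u zeroSeq) j) →
        excess p q x k - q ≤ excess p q x N ∨
          ∃ k', True ∧ k < k' ∧ k' ≤ N ∧ excess p q x k ≤ excess p q x k' := by
      intro hag
      rcases le_or_gt (N - k) q with h | h
      · have := hagree q le_rfl hag (N - k) h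
        rw [Nat.add_sub_cancel' hkN] at this
        exact Or.inl this
      · refine Or.inr ⟨k + q, trivial, by omega, by omega, ?_⟩
        have hN := excess_add p q x k q
        rw [ones_congr hag, hu.ones_pre _ le_rfl, Nat.mul_div_cancel_left _ hq] at hN
        have : (q : ℤ) * p = p * q := mul_comm _ _
        omega
    rcases (hlow k).eq_or_lt with heq | hlt
    · exact hblock fun j _ => by rw [heq]
    obtain ⟨i, hag, hm, hy⟩ := lt_iff_exists.1 hlt
    rcases le_or_gt q i with hi | hi
    · exact hblock fun j hj => (hag j (by omega)).symm
    rcases le_or_gt (N - k) i with h | h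
    · have := hagree i hi.le (fun j hj => (hag j hj).symm) (N - k) h
      rw [Nat.add_sub_cancel' hkN] at this
      exact Or.inl this
    refine Or.inr ⟨k + (i + 1), trivial, by omega, by omega, ?_⟩
    have hN := excess_add p q x k (i + 1)
    rw [ones_succ, ← ones_congr hag, hu.ones_pre _ hi.le, hy] at hN
    rw [ofLex_pre_of_lt (by rw [hu.length]; exact hi), hu.getD_eq hi, mech_eq_zero_iff, add_zero,
      add_zero] at hm
    have hd := Nat.lt_mul_div_succ ((i + 1) * p) hq
    have hd2 := Nat.mul_le_mul_left q hm
    rw [Nat.mul_add] at hd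
    have hd' : (p : ℤ) * (i + 1 : ℕ) < q * (i * p / q + 1 : ℕ) := by
      have : p * (i + 1) < q * (i * p / q + 1) := by
        rw [Nat.mul_comm p, Nat.mul_add q]; omega
      exact_mod_cast this
    simp only [Fin.val_one] at hN
    omega
  have hesc : ∀ k, True → ∃ k', True ∧ -excess p q x k + 1 ≤ -excess p q x k' := by
    intro k _
    obtain ⟨i, hag, hx, hm⟩ := lt_iff_exists.1 (hup k)
    refine ⟨k + (i + 1), trivial, ?_⟩
    have hN := excess_add p q x k (i + 1)
    rw [ones_succ, ones_congr hag, ones_mech hu.lt.le (by omega), hx] at hN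
    rw [mech_eq_one_iff] at hm
    have hd := Nat.mul_div_le ((i + 1) * p + (q - 1)) q
    have hd2 := Nat.mul_le_mul_left q (Nat.succ_le_of_lt hm)
    rw [Nat.succ_eq_add_one, Nat.mul_add] at hd2
    have hd' : (q : ℤ) * ((i * p + (q - 1)) / q : ℕ) < p * (i + 1 : ℕ) := by
      have : q * ((i * p + (q - 1)) / q) < p * (i + 1) := by
        rw [Nat.mul_comm p]; omega
      exact_mod_cast this
    simp only [Fin.val_zero, add_zero] at hN
    omega
  obtain ⟨k, -, hbig⟩ := exists_add_le_of_step hesc (k₀ := 0) trivial (q + 1)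
  have := hbelow k 0 trivial (Nat.zero_le _)
  push_cast at hbig
  omega

/-! ### The substitution `0 ↦ 0`, `1 ↦ u` -/

/-- The image of a letter under the substitution `0 ↦ 0`, `1 ↦ u`. -/
def block (u : Word) (a : Fin 2) : Word := if a = 0 then [0] else u

/-- The image of a word under the substitution `0 ↦ 0`, `1 ↦ u`. -/
def substWord (u v : Word) : Word := v.flatMap (block u)

theorem block_ne_nil {u : Word} (hu : u ≠ []) (a : Fin 2) : block u a ≠ [] := by
  unfold block; split_ifs <;> simp [hu]

/-- The `j`-th letter of the image of the sequence `y` under `0 ↦ 0`, `1 ↦ u`. For empty `u` the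
recursion is cut off and the value is irrelevant. -/
def substLetter (u : Word) (y : BinSeq) (j : ℕ) : Fin 2 :=
  if j < (block u (ofLex y 0)).length ∨ u = [] then (block u (ofLex y 0)).getD j 0
  else substLetter u (shift 1 y) (j - (block u (ofLex y 0)).length)
termination_by j
decreasing_by
  rename_i h
  push Not at h
  have := List.length_pos_iff.2 (block_ne_nil h.2 (ofLex y 0))
  omega

/-- The image of the sequence `y` under the substitution `0 ↦ 0`, `1 ↦ u`. -/
def subst (u : Word) (y : BinSeq) : BinSeq := toLex (substLetter u y)

section

variable {u : Word}

theorem subst_eq (hu : u ≠ []) (y : BinSeq) :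
    subst u y = pre (block u (ofLex y 0)) (subst u (shift 1 y)) := by
  refine seq_ext fun j => ?_
  change substLetter u y j = _
  rw [substLetter, ofLex_pre]
  split_ifs with h1 h2 h2
  · rfl
  · exact absurd (h1.resolve_left h2) hu
  · exact absurd (Or.inl h2) h1
  · rfl

theorem subst_of_head_eq_zero (hu : u ≠ []) {y : BinSeq} (h : ofLex y 0 = 0) :
    subst u y = pre [0] (subst u (shift 1 y)) := by
  conv_lhs => rw [subst_eq hu, h]
  rfl

theorem subst_of_head_eq_one (hu : u ≠ []) {y : BinSeq} (h : ofLex y 0 = 1) :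
    subst u y = pre u (subst u (shift 1 y)) := by
  conv_lhs => rw [subst_eq hu, h]
  rfl

theorem subst_pre (hu : u ≠ []) (v : Word) (y : BinSeq) :
    subst u (pre v y) = pre (substWord u v) (subst u y) := by
  induction v with
  | nil => rfl
  | cons a v ih =>
    have h1 : shift 1 (pre (a :: v) y) = pre v y := by
      rw [← List.singleton_append, pre_append]
      exact shift_length_pre [a] _
    rw [subst_eq hu, h1, ih, ← pre_append]
    rfl

theorem per_substWord (hu : u ≠ []) {w : Word} (hw : w ≠ []) :
    per (substWord u w) = subst u (per w) := by
  have hne : substWord u w ≠ [] := by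
    obtain ⟨a, v, rfl⟩ := List.exists_cons_of_ne_nil hw
    simp [substWord, block_ne_nil hu]
  exact (eq_per_of_pre_eq hne (by rw [← subst_pre hu, pre_per hw])).symm

/-- A sequence is an image under the substitution if one can split off blocks forever. -/
theorem exists_eq_subst (hu : u ≠ []) {G : BinSeq → Prop}
    (h : ∀ x, G x → ∃ a x', G x' ∧ x = pre (block u a) x') {x : BinSeq} (hx : G x) :
    ∃ y, x = subst u y := by
  choose! a next hG heq using h
  have hit : ∀ i, G (next^[i] x) := by
    intro i
    induction i with
    | zero => exact hx
    | succ i ih => rw [Function.iterate_succ_apply']; exact hG _ ih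
  let y : BinSeq → BinSeq := fun x => toLex fun i => a (next^[i] x)
  refine ⟨y x, seq_ext fun j => ?_⟩
  induction j using Nat.strong_induction_on generalizing x with
  | _ j ih =>
    have h1 : shift 1 (y x) = y (next x) := rfl
    have h2 : ofLex (y x) 0 = a x := rfl
    rw [subst_eq hu, h1, h2]
    conv_lhs => rw [heq x hx]
    rw [ofLex_pre, ofLex_pre]
    split_ifs with hj
    · rfl
    · have := List.length_pos_iff.2 (block_ne_nil hu (a x))
      exact ih _ (by omega) (hit 1) fun i => hit (i + 1)

theorem exists_shift_subst (hu : u ≠ []) (j : ℕ) (y : BinSeq) :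
    ∃ k, shift k (subst u y) = subst u (shift j y) := by
  induction j generalizing y with
  | zero => exact ⟨0, rfl⟩
  | succ j ih =>
    obtain ⟨k, hk⟩ := ih (shift 1 y)
    refine ⟨(block u (ofLex y 0)).length + k, ?_⟩
    rw [subst_eq hu, ← shift_shift, shift_length_pre, hk, shift_shift, Nat.add_comm]

/-- If `u` begins with `0^n`, so does every image under the substitution. -/
theorem subst_begins_with_zeros (hu : u ≠ []) {n : ℕ} (h0 : ∀ i < n, u.getD i 0 = 0)
    (hn : n < u.length) (y : BinSeq) {i : ℕ} (hi : i < n) : ofLex (subst u y) i = 0 := by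
  induction i generalizing y with
  | zero =>
    rcases fin2_cases (ofLex y 0) with h | h
    · rw [subst_of_head_eq_zero hu h]; rfl
    · rw [subst_of_head_eq_one hu h, ofLex_pre_of_lt (by omega), h0 _ hi]
  | succ i ih =>
    rcases fin2_cases (ofLex y 0) with h | h
    · rw [subst_of_head_eq_zero hu h]
      exact ih _ (by omega)
    · rw [subst_of_head_eq_one hu h, ofLex_pre_of_lt (by omega), h0 _ hi]

/-- The image of a sequence that begins with `0` begins with `0^{n+1}`. -/
theorem subst_begins_with_zeros_succ (hu : u ≠ []) {n : ℕ} (h0 : ∀ i < n, u.getD i 0 = 0)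
    (hn : n < u.length) {y : BinSeq} (hy : ofLex y 0 = 0) {i : ℕ} (hi : i ≤ n) :
    ofLex (subst u y) i = 0 := by
  rw [subst_of_head_eq_zero hu hy]
  cases i with
  | zero => rfl
  | succ i => exact subst_begins_with_zeros hu h0 hn _ hi

theorem lt_pre_of_zeros {n : ℕ} (h0 : ∀ i < n, u.getD i 0 = 0) (h1 : u.getD n 0 = 1)
    (hn : n < u.length) {x : BinSeq} (hx : ∀ i ≤ n, ofLex x i = 0) (z : BinSeq) :
    x < pre u z := by
  refine lt_iff_exists.2 ⟨n, fun j hj => ?_, hx n le_rfl, ?_⟩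
  · rw [hx j hj.le, ofLex_pre_of_lt (by omega), h0 j hj]
  · rw [ofLex_pre_of_lt hn, h1]

theorem subst_strictMono (hu : u ≠ []) {n : ℕ} (h0 : ∀ i < n, u.getD i 0 = 0)
    (h1 : u.getD n 0 = 1) (hn : n < u.length) : StrictMono (subst u) := by
  intro y z hyz
  obtain ⟨i, hag, hy, hz⟩ := lt_iff_exists.1 hyz
  clear hyz
  induction i generalizing y z with
  | zero =>
    rw [subst_of_head_eq_one hu hz]
    exact lt_pre_of_zeros h0 h1 hn (fun i hi => subst_begins_with_zeros_succ hu h0 hn hy hi) _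
  | succ i ih =>
    rw [subst_eq hu y, subst_eq hu z, hag 0 (by omega)]
    exact pre_lt_pre (ih (fun j hj => hag (j + 1) (by omega)) hy hz)

/-- A tail of an image either is the image of a tail, or begins inside a block `u` and then
exceeds every sequence beginning with `u`. -/
theorem IsLowerWord.shift_subst {p q : ℕ} (hu : IsLowerWord p q u) (k : ℕ) (y : BinSeq) :
    (∃ j, shift k (subst u y) = subst u (shift j y)) ∨
      ∀ z, pre u z < shift k (subst u y) := by
  induction k using Nat.strong_induction_on generalizing y with
  | _ k ih =>
    rcases Nat.eq_zero_or_pos k with rfl | hk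
    · exact Or.inl ⟨0, rfl⟩
    have hrec : ∀ (v : Word), v ≠ [] → v.length ≤ k →
        subst u y = pre v (subst u (shift 1 y)) →
        (∃ j, shift k (subst u y) = subst u (shift j y)) ∨
          ∀ z, pre u z < shift k (subst u y) := by
      intro v hv hvk hsub
      have := List.length_pos_iff.2 hv
      rw [hsub, shift_pre hvk]
      refine (ih (k - v.length) (by omega) (shift 1 y)).imp_left fun ⟨j, hj⟩ => ?_
      exact ⟨1 + j, by rw [hj, shift_shift]⟩
    rcases fin2_cases (ofLex y 0) with h | h
    · exact hrec [0] (by simp) hk (subst_of_head_eq_zero hu.ne_nil h)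
    · have hsub := subst_of_head_eq_one hu.ne_nil h
      rcases lt_or_ge k q with hkq | hkq
      · right
        intro z
        rw [hsub]
        exact hu.pre_lt_shift_pre hk hkq _ _
      · exact hrec u hu.ne_nil (hu.length ▸ hkq) hsub

end

/-! ### Words of the Farey tree as mechanical words -/

theorem FareyNeighbours.exists_substWord {u U V : Word} {a c : ℚ}
    (h : FareyNeighbours [0] u a U c V) :
    ∃ U' V', FareyNeighbours [0] [1] a U' c V' ∧ U = substWord u U' ∧ V = substWord u V' := by
  induction h with
  | root => exact ⟨_, _, .root, by simp [substWord, block], by simp [substWord, block]⟩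
  | left _ ih =>
    obtain ⟨U', V', h, rfl, rfl⟩ := ih
    exact ⟨_, _, h.left, rfl, by simp [substWord]⟩
  | right _ ih =>
    obtain ⟨U', V', h, rfl, rfl⟩ := ih
    exact ⟨_, _, h.right, by simp [substWord], rfl⟩

/-- `U` is one period of the largest sequence `mech p q (q - 1)` of its orbit, where `p/q` is the
rational `a` in lowest terms. -/
structure IsUpperWord (a : ℚ) (U : Word) : Prop where
  num_nonneg : 0 ≤ a.num
  num_le : a.num ≤ a.den
  length : U.length = a.den
  per_eq : per U = mech a.num.toNat a.den (a.den - 1)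

/-- `(i p + (q - 1)) / q` is the ceiling of `i p / q`. -/
theorem ceilDiv_eq_iff {p q i r : ℕ} (hq : 0 < q) :
    (i * p + (q - 1)) / q = r ↔ i * p ≤ q * r ∧ q * r < i * p + q := by
  rw [Nat.div_eq_iff hq, Nat.mul_comm r q]
  omega

/-- Up to the length of the right parent, the upper word of the mediant agrees with that of the
right parent. -/
theorem ceilDiv_mediant_of_le {p q p' q' i : ℕ} (hq : 0 < q) (hq' : 0 < q')
    (hdet : p' * q = p * q' + 1) (hi : i ≤ q') :
    (i * (p + p') + (q + q' - 1)) / (q + q') = (i * p' + (q' - 1)) / q' := by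
  obtain ⟨h1, h2⟩ := (ceilDiv_eq_iff (i := i) (p := p') hq').1 rfl
  set r := (i * p' + (q' - 1)) / q'
  rw [ceilDiv_eq_iff (by omega)]
  zify at *
  have h3 : q' * (i * p - q * r : ℤ) ≤ -i := by nlinarith
  have h4 : (i * p - q * r : ℤ) ≤ 0 := by nlinarith
  have h5 : q' * (q * r - i * p - q : ℤ) < q' := by nlinarith
  have h6 : (q * r - i * p - q : ℤ) < 1 := by nlinarith
  constructor <;> linarith

/-- After the length of the right parent, the upper word of the mediant agrees with that of the
left parent. -/
theorem ceilDiv_mediant_add {p q p' q' i : ℕ} (hq : 0 < q) (hq' : 0 < q')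
    (hdet : p' * q = p * q' + 1) (hi : i ≤ q) :
    ((i + q') * (p + p') + (q + q' - 1)) / (q + q') = p' + (i * p + (q - 1)) / q := by
  obtain ⟨h1, h2⟩ := (ceilDiv_eq_iff (i := i) (p := p) hq).1 rfl
  set r := (i * p + (q - 1)) / q
  rw [ceilDiv_eq_iff (by omega)]
  zify at *
  have h3 : q * (i * p' - q' * r : ℤ) ≤ i := by nlinarith
  have h4 : (i * p' - q' * r : ℤ) ≤ 1 := by nlinarith
  have h5 : q * (q' * r - i * p' - q' : ℤ) < 0 := by nlinarith
  have h6 : (q' * r - i * p' - q' : ℤ) < 0 := by nlinarith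
  constructor <;> nlinarith

theorem mech_ceil_periodic {p q c : ℕ} (hq : 0 < q) (hc : c < q) :
    shift q (mech p q c) = mech p q c := by
  rw [shift_mech hq, Nat.add_mul_mod_self_left, Nat.mod_eq_of_lt hc]

theorem per_append_eq_mech {p q p' q' : ℕ} {U V : Word} (hq : 0 < q) (hq' : 0 < q')
    (hdet : p' * q = p * q' + 1) (hUl : U.length = q) (hVl : V.length = q')
    (hU : per U = mech p q (q - 1)) (hV : per V = mech p' q' (q' - 1)) :
    per (V ++ U) = mech (p + p') (q + q') (q + q' - 1) := by
  have hne : V ++ U ≠ [] := by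
    intro h
    have := congrArg List.length h
    rw [List.length_append, List.length_nil] at this
    omega
  refine (eq_per_of_pre_eq hne ?_).symm
  set M := mech (p + p') (q + q') (q + q' - 1)
  have hM : shift (q + q') M = M := mech_ceil_periodic (by omega) (by omega)
  have h1 : M = pre V (shift q' M) := by
    rw [← hVl]
    refine eq_pre_shift fun i hi => ?_
    have h : ofLex (per V) i = V.getD i 0 := by rw [ofLex_per, Nat.mod_eq_of_lt hi]
    rw [← h, hV]
    have e1 := ceilDiv_mediant_of_le hq hq' hdet (i := i) (by omega)
    have e2 := ceilDiv_mediant_of_le hq hq' hdet (i := i + 1) (by omega)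
    have key : ofLex M i = 1 ↔ ofLex (mech p' q' (q' - 1)) i = 1 := by
      rw [mech_eq_one_iff, mech_eq_one_iff, e1, e2]
    omega
  have h2 : shift q' M = pre U (shift q (shift q' M)) := by
    rw [← hUl]
    refine eq_pre_shift fun i hi => ?_
    have h : ofLex (per U) i = U.getD i 0 := by rw [ofLex_per, Nat.mod_eq_of_lt hi]
    rw [← h, hU]
    have e1 := ceilDiv_mediant_add hq hq' hdet (i := i) (by omega)
    have e2 := ceilDiv_mediant_add hq hq' hdet (i := i + 1) (by omega)
    have key : ofLex (shift q' M) i = 1 ↔ ofLex (mech p q (q - 1)) i = 1 := by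
      rw [ofLex_shift, mech_eq_one_iff, mech_eq_one_iff, e1, Nat.add_right_comm, e2]
      omega
    omega
  rw [shift_shift, Nat.add_comm, hM] at h2
  rw [pre_append, ← h2, ← h1]

theorem mediant_num_den {a c : ℚ} (hdet : c.num * a.den = a.num * c.den + 1) :
    (mediant a c).num = a.num + c.num ∧ (mediant a c).den = a.den + c.den := by
  have hpos : (0 : ℤ) < a.den + c.den := by have := a.pos; positivity
  have hcop : Nat.Coprime (a.num + c.num).natAbs ((a.den : ℤ) + c.den).natAbs := by
    rw [← Int.isCoprime_iff_nat_coprime]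
    exact ⟨a.den, -a.num, by linarith⟩
  have hm : mediant a c = ((a.num + c.num : ℤ) : ℚ) / (((a.den : ℤ) + c.den : ℤ) : ℚ) := by
    simp [mediant]
  constructor
  · rw [hm, Rat.num_div_eq_of_coprime hpos hcop]
  · have := Rat.den_div_eq_of_coprime hpos hcop
    rw [← hm] at this
    exact_mod_cast this

theorem IsUpperWord.mediant {a c : ℚ} {U V : Word} (hU : IsUpperWord a U) (hV : IsUpperWord c V)
    (hdet : c.num * a.den = a.num * c.den + 1) : IsUpperWord (mediant a c) (V ++ U) := by
  obtain ⟨hn, hd⟩ := mediant_num_den hdet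
  have h1 := hU.num_nonneg
  have h2 := hV.num_nonneg
  have h3 := hU.num_le
  have h4 := hV.num_le
  refine ⟨by omega, by omega, ?_, ?_⟩
  · rw [List.length_append, hU.length, hV.length, hd, Nat.add_comm]
  · rw [hn, hd, Int.toNat_add h1 h2]
    refine per_append_eq_mech a.pos c.pos ?_ hU.length hV.length hU.per_eq hV.per_eq
    zify
    rw [Int.toNat_of_nonneg h1, Int.toNat_of_nonneg h2, hdet]

theorem FareyNeighbours.isUpperWord {a c : ℚ} {U V : Word} (h : FareyNeighbours [0] [1] a U c V) :
    IsUpperWord a U ∧ IsUpperWord c V ∧ c.num * a.den = a.num * c.den + 1 := by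
  induction h with
  | root =>
    refine ⟨⟨by simp, by simp, rfl, ?_⟩, ⟨by simp, by simp, rfl, ?_⟩, by simp⟩
    · refine seq_ext fun i => ?_
      have : ofLex (mech 0 1 0) i = 0 := mech_eq_zero_iff.2 (by simp)
      simpa [per, Nat.mod_one] using this.symm
    · refine seq_ext fun i => ?_
      have : ofLex (mech 1 1 0) i = 1 := mech_eq_one_iff.2 (by simp)
      simpa [per, Nat.mod_one] using this.symm
  | left _ ih =>
    obtain ⟨hU, hV, hdet⟩ := ih
    obtain ⟨hn, hd⟩ := mediant_num_den hdet
    refine ⟨hU, hU.mediant hV hdet, ?_⟩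
    rw [hn, hd]; push_cast; linarith
  | right _ ih =>
    obtain ⟨hU, hV, hdet⟩ := ih
    obtain ⟨hn, hd⟩ := mediant_num_den hdet
    refine ⟨hU.mediant hV hdet, hV, ?_⟩
    rw [hn, hd]; push_cast; linarith

/-- A non-root label lies strictly between `0` and `1`. -/
theorem IsFareyWord.isUpperWord {γ : ℚ} {w : Word} (h : IsFareyWord [0] [1] γ w) :
    IsUpperWord γ w ∧ 0 < γ.num ∧ γ.num < γ.den := by
  obtain ⟨a, U, c, V, h, rfl, rfl⟩ := h
  obtain ⟨hU, hV, hdet⟩ := h.isUpperWord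
  obtain ⟨hn, hd⟩ := mediant_num_den hdet
  refine ⟨hU.mediant hV hdet, ?_⟩
  have h1 := hU.num_nonneg
  have h2 := hV.num_nonneg
  have h3 := hU.num_le
  have h4 := hV.num_le
  have h5 := a.pos
  have h6 := c.pos
  have hc0 : c.num ≠ 0 := fun h0 => by
    rw [h0, zero_mul] at hdet
    have : 0 ≤ a.num * c.den := by positivity
    omega
  have ha1 : a.num ≠ a.den := fun h0 => by
    rw [h0] at hdet
    nlinarith
  rw [hn, hd]
  omega

/-- The left neighbour is a non-root word unless its label is `0`. -/
theorem FareyNeighbours.left_eq_zero_or_isFareyWord {l r U V : Word} {a c : ℚ}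
    (h : FareyNeighbours l r a U c V) : a = 0 ∨ IsFareyWord l r a U := by
  induction h with
  | root => exact Or.inl rfl
  | left _ ih => exact ih
  | right h _ => exact Or.inr ⟨_, _, _, _, h, rfl, rfl⟩

theorem IsMinBalancedWord.isLowerWord {γ : ℚ} {u : Word} (h : IsMinBalancedWord γ u) :
    IsLowerWord γ.num.toNat γ.den u := by
  obtain ⟨w, hw, hrot, hmin⟩ := h
  obtain ⟨hup, h0, h1⟩ := IsFareyWord.isUpperWord hw
  have hcop : γ.num.toNat.Coprime γ.den := by
    have := γ.reduced
    rwa [show γ.num.natAbs = γ.num.toNat by omega] at this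
  have hd := γ.pos
  have hlen := hrot.perm.length_eq
  refine ⟨by omega, by omega, hcop, hlen.trans hup.length, le_antisymm ?_ ?_⟩
  · obtain ⟨k, hk⟩ := exists_shift_mech hcop (c := γ.den - 1) (c' := 0) hd (by omega)
    rw [← hk, ← hup.per_eq, ← per_rotate]
    exact per_le_per (by simp [hlen]) (hmin (List.IsRotated.forall w k))
  · obtain ⟨k, hk⟩ := exists_shift_of_isRotated hrot
    rw [hk, hup.per_eq, shift_mech hd]
    exact mech_mono (by omega) (Nat.zero_le _) (Nat.mod_lt _ hd)

/-! ### The pairs of the Farey tree with roots `0` and `u` -/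

/-- The combinatorial content of membership in the Farey tree with roots `0` and `u`: the word `u`
is a lower word of slope `p/q` beginning with `0^n 1`, and `w` is the image under `0 ↦ 0`, `1 ↦ u`
of an upper word of slope `P/Q`. -/
structure IsTreePair (p q n P Q : ℕ) (u w s t : Word) : Prop where
  lower : IsLowerWord p q u
  zeros : ∀ i < n, u.getD i 0 = 0
  one : u.getD n 0 = 1
  lt_length : n < u.length
  pos : 0 < P
  lt : P < Q
  coprime : P.Coprime Q
  per_eq : per w = subst u (mech P Q (Q - 1))
  max : IsMaxRotation (List.replicate (n + 1) 0) w s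
  min : IsMinRotation (List.replicate n 0 ++ [1]) w t

theorem zeroSeq_le (x : BinSeq) : zeroSeq ≤ x :=
  le_of_ones fun i => by
    have : ones zeroSeq i = 0 := Finset.sum_eq_zero fun _ _ => rfl
    omega

theorem getD_replicate_zero {m i : ℕ} : (List.replicate m (0 : Fin 2)).getD i 0 = 0 := by
  rcases lt_or_ge i m with h | h
  · rw [List.getD_eq_getElem _ _ (by simpa using h)]; simp
  · rw [List.getD_eq_default _ _ (by simpa using h)]

theorem getD_replicate_zero_append {n i : ℕ}
    (hi : i < (List.replicate n (0 : Fin 2) ++ [1]).length) :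
    (List.replicate n (0 : Fin 2) ++ [1]).getD i 0 = if i < n then 0 else 1 := by
  simp only [List.length_append, List.length_replicate, List.length_singleton] at hi
  split_ifs with h
  · rw [List.getD_append _ _ _ _ (by simpa using h), getD_replicate_zero]
  · obtain rfl : i = n := by omega
    rw [List.getD_append_right _ _ _ _ (by simp)]
    simp

namespace IsTreePair

variable {p q n P Q : ℕ} {u w s t : Word}

theorem per_s_zero (h : IsTreePair p q n P Q u w s t) {i : ℕ} (hi : i ≤ n) :
    ofLex (per s) i = 0 := by
  rw [getD_of_prefix h.max.1.2 (by simpa using Nat.lt_succ_of_le hi), getD_replicate_zero]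

theorem per_t_apply (h : IsTreePair p q n P Q u w s t) {i : ℕ} (hi : i ≤ n) :
    ofLex (per t) i = if i < n then 0 else 1 := by
  have hi' : i < (List.replicate n (0 : Fin 2) ++ [1]).length := by simp; omega
  rw [getD_of_prefix h.min.1.2 hi', getD_replicate_zero_append hi']

theorem shift_le_per_s (h : IsTreePair p q n P Q u w s t) {k : ℕ}
    (hk : ∀ i ≤ n, ofLex (shift k (per w)) i = 0) : shift k (per w) ≤ per s := by
  refine h.max.shift_le fun i hi => ?_
  rw [getD_replicate_zero]
  exact hk i (by simpa [Nat.lt_succ_iff] using hi)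

theorem per_t_le_shift (h : IsTreePair p q n P Q u w s t) {k : ℕ}
    (hk : ∀ i < n, ofLex (shift k (per w)) i = 0) (hn : ofLex (shift k (per w)) n = 1) :
    per t ≤ shift k (per w) := by
  refine h.min.le_shift fun i hi => ?_
  rw [getD_replicate_zero_append hi]
  split_ifs with h1
  · exact hk i h1
  · have : i < n + 1 := by simpa using hi
    obtain rfl : i = n := by omega
    exact hn

theorem per_s_lt_pre (h : IsTreePair p q n P Q u w s t) (z : BinSeq) : per s < pre u z :=
  lt_pre_of_zeros h.zeros h.one h.lt_length (fun _ hi => h.per_s_zero hi) z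

/-- No element of the orbit lies strictly between `s^∞` and `t^∞`. -/
theorem shift_le_or_le_shift (h : IsTreePair p q n P Q u w s t) (k : ℕ) :
    shift k (per w) ≤ per s ∨ per t ≤ shift k (per w) := by
  classical
  by_cases hz : ∀ i ≤ n, ofLex (shift k (per w)) i = 0
  · exact Or.inl (h.shift_le_per_s hz)
  right
  push Not at hz
  have hspec := Nat.find_spec hz
  have hmin : ∀ i < Nat.find hz, ofLex (shift k (per w)) i = 0 := fun i hi => by
    have := Nat.find_min hz hi
    push Not at this
    exact this (hi.le.trans hspec.1)
  have h1 : ofLex (shift k (per w)) (Nat.find hz) = 1 :=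
    (fin2_cases _).resolve_left hspec.2
  rcases hspec.1.eq_or_lt with heq | hlt
  · rw [heq] at hmin h1
    exact h.per_t_le_shift hmin h1
  · refine (lt_iff_exists.2 ⟨Nat.find hz, fun j hj => ?_, ?_, h1⟩).le
    · rw [hmin j hj, h.per_t_apply (by omega), if_pos (by omega)]
    · rw [h.per_t_apply hlt.le, if_pos hlt]

theorem exists_per_s (h : IsTreePair p q n P Q u w s t) : ∃ k, per s = shift k (per w) :=
  exists_shift_of_isRotated h.max.1.1

theorem exists_per_w (h : IsTreePair p q n P Q u w s t) : ∃ k, per w = shift k (per s) :=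
  exists_shift_of_isRotated h.max.1.1.symm

theorem strictMono (h : IsTreePair p q n P Q u w s t) : StrictMono (subst u) :=
  subst_strictMono h.lower.ne_nil h.zeros h.one h.lt_length

theorem per_s_le (h : IsTreePair p q n P Q u w s t) :
    per s ≤ subst u (mech P Q (Q - P - 1)) := by
  have hlt := h.lt
  obtain ⟨k, hk⟩ := h.exists_per_s
  rw [h.per_eq] at hk
  rcases h.lower.shift_subst k (mech P Q (Q - 1)) with ⟨j, hj⟩ | hbig
  · rw [hk, hj, shift_mech (by omega)]
    set c := (Q - 1 + j * P) % Q with hc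
    have hcQ : c < Q := Nat.mod_lt _ (by omega)
    refine h.strictMono.monotone (mech_mono hlt.le ?_ (by omega))
    by_contra! hlarge
    have hhead : ofLex (mech P Q c) 0 = 1 := (mech_head_eq_one_iff hcQ).2 (by omega)
    have := h.per_s_lt_pre (subst u (shift 1 (mech P Q c)))
    rw [hk, hj, shift_mech (by omega), ← hc, ← subst_of_head_eq_one h.lower.ne_nil hhead] at this
    exact lt_irrefl _ this
  · rw [← hk] at hbig
    exact absurd (hbig zeroSeq) (h.per_s_lt_pre zeroSeq).not_gt

theorem mech_hole_head (h : IsTreePair p q n P Q u w s t) : ofLex (mech P Q (Q - P)) 0 = 1 := by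
  have h1 := h.lt
  have h2 := h.pos
  exact (mech_head_eq_one_iff (by omega)).2 (by omega)

theorem le_per_t (h : IsTreePair p q n P Q u w s t) :
    subst u (mech P Q (Q - P)) ≤ per t := by
  have hlt := h.lt
  obtain ⟨k, hk⟩ := exists_shift_of_isRotated h.min.1.1
  rw [h.per_eq] at hk
  rcases h.lower.shift_subst k (mech P Q (Q - 1)) with ⟨j, hj⟩ | hbig
  · rw [hk, hj, shift_mech (by omega)]
    set c := (Q - 1 + j * P) % Q with hc
    have hcQ : c < Q := Nat.mod_lt _ (by omega)
    refine h.strictMono.monotone (mech_mono hlt.le ?_ hcQ)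
    by_contra! hsmall
    have hhead : ofLex (mech P Q c) 0 = 0 := by
      refine (fin2_cases _).resolve_right fun h1 => ?_
      rw [mech_head_eq_one_iff hcQ] at h1
      omega
    have h0 := subst_begins_with_zeros_succ h.lower.ne_nil h.zeros h.lt_length hhead le_rfl
    rw [hc, ← shift_mech (by omega), ← hj, ← hk, h.per_t_apply le_rfl, if_neg (lt_irrefl n)] at h0
    exact absurd h0 (by decide)
  · rw [← hk] at hbig
    rw [subst_of_head_eq_one h.lower.ne_nil h.mech_hole_head]
    exact (hbig _).le

theorem pre_zeroSeq_le_per_t (h : IsTreePair p q n P Q u w s t) : pre u zeroSeq ≤ per t := by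
  refine le_trans ?_ h.le_per_t
  rw [subst_of_head_eq_one h.lower.ne_nil h.mech_hole_head]
  exact pre_le_pre (zeroSeq_le _)

/-- The orbit of `w^∞` visits the image of the upper end of the hole of slope `P/Q`; there it
begins with `u`. -/
theorem exists_shift_per_w (h : IsTreePair p q n P Q u w s t) :
    ∃ k, shift k (per w) = subst u (mech P Q (Q - P)) := by
  have h1 := h.lt
  have h2 := h.pos
  obtain ⟨j, hj⟩ := exists_shift_mech h.coprime (c := Q - 1) (c' := Q - P) (by omega) (by omega)
  obtain ⟨k, hk⟩ := exists_shift_subst h.lower.ne_nil j (mech P Q (Q - 1))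
  exact ⟨k, by rw [h.per_eq, hk, hj]⟩

theorem per_t_lt (h : IsTreePair p q n P Q u w s t) : per t < mech p q 0 := by
  have h1 := h.lt
  have h2 := h.pos
  obtain ⟨k, hk⟩ := h.exists_shift_per_w
  have hne := h.lower.ne_nil
  have hu : subst u (mech P Q (Q - P)) = pre u (subst u (mech P Q 0)) := by
    rw [subst_of_head_eq_one hne h.mech_hole_head, shift_mech (by omega), one_mul,
      Nat.sub_add_cancel h1.le, Nat.mod_self]
  have hhead : ofLex (mech P Q 0) 0 = 0 := by
    refine (fin2_cases _).resolve_right fun h1 => ?_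
    rw [mech_head_eq_one_iff (by omega)] at h1
    omega
  have hle : per t ≤ shift k (per w) := by
    refine h.per_t_le_shift (fun i hi => ?_) ?_
    · rw [hk, hu, ofLex_pre_of_lt (hi.trans h.lt_length), h.zeros i hi]
    · rw [hk, hu, ofLex_pre_of_lt h.lt_length, h.one]
  refine hle.trans_lt ?_
  rw [hk, hu, ← h.lower.per_eq, ← pre_per hne]
  refine pre_lt_pre ?_
  rw [← pre_per hne]
  exact lt_pre_of_zeros h.zeros h.one h.lt_length
    (fun i hi => subst_begins_with_zeros_succ hne h.zeros h.lt_length hhead hi) _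

theorem isExtremalPair (h : IsTreePair p q n P Q u w s t) : IsExtremalPair s t where
  rotated := h.min.1.1.trans h.max.1.1.symm
  lt := (h.per_s_lt_pre zeroSeq).trans_le h.pre_zeroSeq_le_per_t
  gap k := by
    obtain ⟨j, hj⟩ := h.exists_per_s
    rw [hj, shift_shift, ← hj]
    exact h.shift_le_or_le_shift _

/-- If a sequence `≤ u^∞` has no tail in the hole, it is the image under `0 ↦ 0`, `1 ↦ u` of
another sequence: a tail below the hole begins with `0` and the rest is again `≤ u^∞`, because
`s^∞ ≤ 0 u^∞`; a tail above it lies between `u 0^∞` and `u^∞`. -/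
theorem exists_eq_subst (h : IsTreePair p q n P Q u w s t) {x : BinSeq} (hx : x ≤ per u)
    (hgap : ∀ k, shift k x ≤ per s ∨ per t ≤ shift k x) : ∃ y, x = subst u y := by
  have hne := h.lower.ne_nil
  have hs : per s ≤ pre [0] (per u) := by
    have hone : subst u (per [1]) = per u := by
      rw [← per_substWord hne (by simp)]
      simp [substWord, block]
    refine h.per_s_le.trans ?_
    have hhead : ofLex (mech P Q (Q - P - 1)) 0 = 0 := by
      have := h.lt
      refine (fin2_cases _).resolve_right fun h1 => ?_
      rw [mech_head_eq_one_iff (by omega)] at h1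
      omega
    rw [subst_of_head_eq_zero hne hhead, ← hone]
    refine pre_le_pre (h.strictMono.monotone (le_of_ones fun i => Finset.sum_le_sum fun j _ => ?_))
    have : ofLex (per [1]) j = 1 := by simp [per, Nat.mod_one]
    rw [this]
    exact fin2_val_le _
  refine BetaHoles.exists_eq_subst hne
    (G := fun x => x ≤ per u ∧ ∀ k, shift k x ≤ per s ∨ per t ≤ shift k x)
    (fun x ⟨hx, hgap⟩ => ?_) ⟨hx, hgap⟩
  have hnext : ∀ a v, block u a = v → v ≠ [] → pre v zeroSeq ≤ x → x ≤ pre v (per u) →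
      ∃ a x', (x' ≤ per u ∧ ∀ k, shift k x' ≤ per s ∨ per t ≤ shift k x') ∧
        x = pre (block u a) x' := by
    rintro a v rfl - h1 h2
    have heq := eq_pre_of_le_of_le h1 h2
    refine ⟨a, _, ⟨?_, fun k => ?_⟩, heq⟩
    · rw [heq] at h2
      exact le_of_pre_le_pre h2
    · rw [shift_shift]
      exact hgap _
  rcases hgap 0 with h0 | h0
  · refine hnext 0 [0] rfl (by simp) ?_ (h0.trans hs)
    have : pre [0] zeroSeq = zeroSeq := seq_ext fun i => by
      rw [ofLex_pre]; split_ifs with hi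
      · simp at hi; subst hi; rfl
      · rfl
    rw [this]
    exact zeroSeq_le x
  · refine hnext 1 u rfl hne (h.pre_zeroSeq_le_per_t.trans h0) ?_
    rwa [pre_per hne]

/-- An extremal pair whose hole contains that of `(s,t)` has the same hole, whatever `β`. -/
theorem hole_maximal (h : IsTreePair p q n P Q u w s t) {s' t' : Word}
    (hext : IsExtremalPair s' t') (hs : per s' ≤ per s) (ht : per t ≤ per t') :
    per s' = per s ∧ per t' = per t := by
  have hne := h.lower.ne_nil
  have hgap : ∀ k, shift k (per s') ≤ per s ∨ per t ≤ shift k (per s') := fun k =>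
    (hext.gap k).imp (fun h => h.trans hs) ht.trans
  have hsu : per s < per u := by
    have := h.per_s_lt_pre (per u)
    rwa [pre_per hne] at this
  obtain ⟨y, hy⟩ := h.exists_eq_subst (hs.trans hsu.le) hgap
  -- the tails of `y` avoid the hole of slope `P/Q`
  have htail1 : ∀ k, ofLex y k = 1 → mech P Q (Q - P) ≤ shift k y := by
    intro k hk
    obtain ⟨m, hm⟩ := exists_shift_subst hne k y
    have hhead : ofLex (shift k y) 0 = 1 := by rw [ofLex_shift, zero_add, hk]
    rw [← h.strictMono.le_iff_le, ← hm, ← hy]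
    refine h.le_per_t.trans ((hgap m).resolve_left fun hle => ?_)
    rw [hy, hm, subst_of_head_eq_one hne hhead] at hle
    exact (h.per_s_lt_pre _).not_ge hle
  have htail0 : ∀ k, ofLex y k = 0 → shift k y ≤ mech P Q (Q - P - 1) := by
    intro k hk
    obtain ⟨m, hm⟩ := exists_shift_subst hne k y
    have hhead : ofLex (shift k y) 0 = 0 := by rw [ofLex_shift, zero_add, hk]
    rw [← h.strictMono.le_iff_le, ← hm, ← hy]
    refine ((hgap m).resolve_right fun hle => ?_).trans h.per_s_le
    rw [hy, hm] at hle
    refine (h.pre_zeroSeq_le_per_t.trans hle).not_gt ?_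
    exact lt_pre_of_zeros h.zeros h.one h.lt_length
      (fun i hi => subst_begins_with_zeros_succ hne h.zeros h.lt_length hhead hi) _
  have hy0 : ofLex y 0 = 0 := by
    refine (fin2_cases _).resolve_right fun h1 => ?_
    rw [hy, subst_of_head_eq_one hne h1] at hs
    exact (h.per_s_lt_pre _).not_ge hs
  obtain ⟨k₁, hk₁⟩ : ∃ k, ofLex y k = 1 := by
    by_contra! hno
    have hy' : y = per [0] := seq_ext fun i => by
      rw [(fin2_cases _).resolve_right (hno i)]
      simp [per, Nat.mod_one]
    have h0 : per s' = per [0] := by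
      rw [hy, hy', ← per_substWord hne (by simp)]
      simp [substWord, block]
    obtain ⟨m, hm⟩ := exists_shift_of_isRotated hext.rotated
    refine hext.lt.ne ?_
    rw [hm, h0]
    exact seq_ext fun i => by simp [per, shift, Nat.mod_one]
  obtain ⟨k, hk⟩ := exists_shift_eq_mech h.lt htail1 htail0 hy0 hk₁ h.pos
  obtain ⟨m, hm⟩ := exists_shift_subst hne k y
  obtain ⟨m', hm'⟩ := h.exists_shift_per_w
  rw [hk, ← hm', ← hy] at hm
  -- both periodic sequences are tails of each other
  obtain ⟨a, ha⟩ := per_eq_shift_of_shift_eq hm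
  obtain ⟨b, hb⟩ := per_eq_shift_of_shift_eq hm.symm
  rw [shift_shift] at ha hb
  have hs_eq : per s' = per s := by
    refine le_antisymm hs ?_
    obtain ⟨c, hc⟩ := h.exists_per_s
    have hc' : per s = shift (m + b + c) (per s') := by rw [hc, hb, shift_shift]
    rcases hext.gap (m + b + c) with hle | hle
    · rwa [hc']
    · rw [← hc'] at hle
      exact absurd (ht.trans hle) h.isExtremalPair.lt.not_ge
  refine ⟨hs_eq, le_antisymm ?_ ht⟩
  obtain ⟨c, hc⟩ := exists_shift_of_isRotated h.isExtremalPair.rotated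
  rcases hext.gap c with hle | hle
  · rw [hs_eq, ← hc] at hle
    exact absurd hle h.isExtremalPair.lt.not_ge
  · rwa [hs_eq, ← hc] at hle

end IsTreePair

/-! ### The number `γ(β)` -/

theorem bddAbove_balanced (β : ℝ) : BddAbove {x : ℝ | ∃ (γ : ℚ) (w : Word),
    IsBalancedWord γ w ∧ per w ∈ admissibleSeqs β ∧ x = (γ : ℝ)} := by
  refine ⟨1, ?_⟩
  rintro _ ⟨γ, w, hw, -, rfl⟩
  obtain ⟨hup, -, -⟩ := IsFareyWord.isUpperWord hw
  have : γ ≤ 1 := by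
    rw [← Rat.num_div_den γ, div_le_one (by exact_mod_cast γ.pos)]
    exact_mod_cast hup.num_le
  exact_mod_cast this

theorem le_gammaOf {β : ℝ} {γ : ℚ} {w : Word} (hw : IsBalancedWord γ w)
    (h : per w ∈ admissibleSeqs β) : (γ : ℝ) ≤ gammaOf β :=
  le_csSup (bddAbove_balanced β) ⟨γ, w, hw, h, rfl⟩

theorem IsUpperWord.shift_le {γ : ℚ} {w : Word} (h : IsUpperWord γ w) (k : ℕ) :
    shift k (per w) ≤ per w := by
  have h1 := γ.pos
  have h2 := h.num_le
  have hm : (γ.den - 1 + k * γ.num.toNat) % γ.den < γ.den := Nat.mod_lt _ h1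
  rw [h.per_eq, shift_mech h1]
  exact mech_mono (by omega) (by omega) (by omega)

theorem IsUpperWord.mem_admissibleSeqs {β : ℝ} {γ : ℚ} {w : Word} (h : IsUpperWord γ w)
    (hle : per w ≤ quasiGreedyOne β) : per w ∈ admissibleSeqs β :=
  fun k => (h.shift_le k).trans hle

/-- If `w_γ^∞` exceeds the quasi-greedy expansion, then so do all `w_γ'^∞` with `γ'` in a
neighbourhood of `γ`, and those with larger `γ'`: the prefix sums `⌈jγ⌉` up to the place of the
first difference do not decrease when `γ` is replaced by a slightly smaller number. -/
theorem gammaOf_lt {β : ℝ} {γ : ℚ} {w : Word} (hw : IsBalancedWord γ w)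
    (h : quasiGreedyOne β < per w) : gammaOf β < γ := by
  obtain ⟨hup, hp0, hpq⟩ := IsFareyWord.isUpperWord hw
  rw [hup.per_eq] at h
  obtain ⟨i, hag, hd, hm⟩ := lt_iff_exists.1 h
  set p := γ.num.toNat with hp
  set q := γ.den with hq
  have hqpos : 0 < q := γ.pos
  have hγ : (γ : ℝ) = p / q := by
    have h1 : ((γ.num : ℤ) : ℝ) = (p : ℕ) := by
      have : γ.num = (p : ℕ) := by omega
      rw [this]; simp
    rw [← h1, hq]
    exact_mod_cast (Rat.num_div_den γ).symm
  have hppos : 0 < p := by omega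
  have hsub : (p : ℝ) / q - 1 / (q * (i + 1)) = ((i + 1) * p - 1) / (q * (i + 1)) := by
    field_simp
  have hε : (0 : ℝ) < 1 / (q * (i + 1)) := by positivity
  suffices hbd : gammaOf β ≤ p / q - 1 / (q * (i + 1)) by
    rw [hγ]; linarith
  refine Real.sSup_le ?_ ?_
  · rintro _ ⟨γ', w', hw', hadm, rfl⟩
    by_contra! hlt
    obtain ⟨hup', hp0', hpq'⟩ := IsFareyWord.isUpperWord hw'
    have h0 : per w' ≤ quasiGreedyOne β := hadm 0
    refine h0.not_gt ?_
    rw [hup'.per_eq]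
    set p' := γ'.num.toNat with hp'
    set q' := γ'.den with hq'
    have hqpos' : 0 < q' := γ'.pos
    have hγ' : (γ' : ℝ) = p' / q' := by
      have h1 : ((γ'.num : ℤ) : ℝ) = (p' : ℕ) := by
        have : γ'.num = (p' : ℕ) := by omega
        rw [this]; simp
      rw [← h1, hq']
      exact_mod_cast (Rat.num_div_den γ').symm
    rw [hγ', hsub, div_lt_div_iff₀ (by positivity) (by positivity)] at hlt
    have hltZ : (((i : ℤ) + 1) * p - 1) * q' < p' * (q * (i + 1)) := by exact_mod_cast hlt
    have hdom : ∀ j ≤ i + 1, (j * p + (q - 1)) / q ≤ (j * p' + (q' - 1)) / q' := by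
      intro j hj
      rcases Nat.eq_zero_or_pos j with rfl | hj0
      · simp [Nat.div_eq_of_lt (by omega : q - 1 < q)]
      obtain ⟨-, h2⟩ := (ceilDiv_eq_iff (i := j) (p := p) hqpos).1 rfl
      set r := (j * p + (q - 1)) / q
      rw [Nat.le_div_iff_mul_le hqpos']
      suffices r * q' < j * p' + q' by omega
      zify at h2 hj hj0 ⊢
      have h3 : (q : ℤ) * (r - 1) ≤ j * p - 1 := by linarith
      have h4 : (i + 1) * ((j * p - 1) * q') < (i + 1) * (j * p' * q : ℤ) := by
        have e1 := mul_lt_mul_of_pos_left hltZ (by omega : (0 : ℤ) < j)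
        have e2 : (j : ℤ) * q' ≤ (i + 1) * q' := by
          exact mul_le_mul_of_nonneg_right hj (by positivity)
        linarith
      have h5 : (j * p - 1) * q' < (j * p' * q : ℤ) := lt_of_mul_lt_mul_left h4 (by positivity)
      have h6 : q * ((r - 1) * q' : ℤ) ≤ (j * p - 1) * q' := by
        rw [← mul_assoc]; exact mul_le_mul_of_nonneg_right h3 (by positivity)
      have h7 : q * ((r - 1) * q' : ℤ) < q * (j * p') := by linarith
      have h8 : ((r - 1) * q' : ℤ) < j * p' := lt_of_mul_lt_mul_left h7 (by positivity)
      linarith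
    refine lt_of_ones (N := i + 1) (fun j hj => ?_) ?_
    · rw [ones_mech (by omega) (by omega)]
      refine le_trans ?_ (hdom j hj)
      rw [← ones_mech (by omega) (by omega)]
      rcases Nat.le_succ_iff.1 hj with hj | rfl
      · exact (ones_congr fun l hl => hag l (by omega)).le
      · rw [ones_succ, ones_succ, ones_congr hag, hd, hm]
        simp
    · rw [ones_mech (by omega) (by omega)]
      refine lt_of_lt_of_le ?_ (hdom (i + 1) le_rfl)
      rw [← ones_mech (by omega) (by omega), ones_succ, ones_succ, ones_congr hag, hd, hm]
      simp
  · rw [hsub]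
    refine div_nonneg ?_ (by positivity)
    have h1 : (1 : ℝ) ≤ p := by exact_mod_cast hppos
    nlinarith

/-- The word `w` contains the suffix of `u` whose length is the denominator of the left Farey
parent `p₁/q₁`. This suffix dominates the upper word of slope `p₁/q₁` and has one more `1`. -/
theorem IsTreePair.exists_lt_shift {p q n P Q : ℕ} {u w s t : Word}
    (h : IsTreePair p q n P Q u w s t) {p₁ q₁ : ℕ} (hdet : p * q₁ = p₁ * q + 1) (hq₁ : 0 < q₁)
    (hlt : q₁ < q) (hp₁ : p₁ ≤ q₁) : ∃ k, mech p₁ q₁ (q₁ - 1) < shift k (per s) := by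
  have hq : 0 < q := by omega
  have hu := h.lower
  obtain ⟨k, hk⟩ := h.exists_shift_per_w
  obtain ⟨m, hm⟩ := h.exists_per_w
  refine ⟨m + (k + (q - q₁)), ?_⟩
  rw [← shift_shift, ← hm, ← shift_shift, hk, subst_of_head_eq_one hu.ne_nil h.mech_hole_head]
  -- since `p q₁ ≡ 1`, the suffix starts at the largest intercept
  have hmod : (q - q₁) * p % q = q - 1 := by
    obtain ⟨e, he⟩ := Nat.exists_eq_add_of_le hlt.le
    have he' : q - q₁ = e := by omega
    have hp₁p : p₁ < p := by
      by_contra! hge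
      have : p * q₁ ≤ p₁ * q := Nat.mul_le_mul hge hlt.le
      omega
    obtain ⟨f, hf⟩ := Nat.exists_eq_add_of_lt hp₁p
    have hsum : e * p = q - 1 + q * f := by
      zify [hq]
      zify at he hdet hf
      have e1 : (e : ℤ) = q - q₁ := by linarith
      have e2 : (f : ℤ) = p - p₁ - 1 := by linarith
      rw [e1, e2]; linarith
    rw [he', hsum, Nat.add_mul_mod_self_left, Nat.mod_eq_of_lt (by omega)]
  have hdom : ∀ i, (i * p₁ + (q₁ - 1)) / q₁ ≤ (i * p + (q - 1)) / q := by
    intro i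
    obtain ⟨-, h2⟩ := (ceilDiv_eq_iff (i := i) (p := p₁) hq₁).1 rfl
    set r := (i * p₁ + (q₁ - 1)) / q₁
    rw [Nat.le_div_iff_mul_le hq]
    suffices r * q < i * p + q by omega
    zify at *
    have h3 : (q₁ : ℤ) * (r - 1) + 1 ≤ i * p₁ := by linarith
    have h4 : q₁ * ((r - 1) * q : ℤ) < q₁ * (i * p) := by
      have e1 : (q₁ * (r - 1) + 1) * q ≤ (i * p₁ * q : ℤ) :=
        mul_le_mul_of_nonneg_right h3 (by positivity)
      have e2 : (q₁ * (i * p) : ℤ) = i * p₁ * q + i := by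
        calc (q₁ * (i * p) : ℤ) = i * (p * q₁) := by ring
          _ = i * p₁ * q + i := by rw [hdet]; ring
      have e3 : (0 : ℤ) ≤ i := by positivity
      rw [e2]
      linarith
    have h5 : ((r - 1) * q : ℤ) < i * p := lt_of_mul_lt_mul_left h4 (by positivity)
    linarith
  refine lt_of_ones (N := q₁) (fun i hi => ?_) ?_
  · rw [ones_mech hp₁ (by omega), hu.ones_shift_pre _ (by omega), hmod]
    exact hdom i
  · rw [ones_mech hp₁ (by omega), hu.ones_shift_pre _ (by omega), hmod]
    have e1 : q₁ * p + (q - 1) = q * (p₁ + 1) := by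
      rw [Nat.mul_comm q₁, hdet, Nat.mul_add, Nat.mul_comm q]; omega
    rw [e1, Nat.mul_div_cancel_left _ hq, Nat.mul_add_div hq₁, Nat.div_eq_of_lt (by omega)]
    omega

/-! ### The maximality criterion -/

theorem IsFareyTreePair.exists_isTreePair {γ : ℚ} {s t : Word} (h : IsFareyTreePair γ s t) :
    ∃ n P Q u w, IsTreePair γ.num.toNat γ.den n P Q u w s t := by
  obtain ⟨n, u, δ, w, h1, h2, hu, ⟨a, U, c, V, hF, rfl, rfl⟩, hs, ht⟩ := h
  have hlow := hu.isLowerWord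
  obtain ⟨U', V', hF', rfl, rfl⟩ := hF.exists_substWord
  have hw : IsFareyWord [0] [1] (mediant a c) (V' ++ U') := ⟨_, _, _, _, hF', rfl, rfl⟩
  obtain ⟨hup, hp0, hpq⟩ := hw.isUpperWord
  have hden : (0 : ℚ) < γ.den := by exact_mod_cast γ.pos
  have hnum : (γ.num.toNat : ℚ) = γ * γ.den := by
    rw [Rat.mul_den_eq_num]
    have := hlow.pos
    have h3 : (γ.num.toNat : ℤ) = γ.num := by omega
    exact_mod_cast h3
  have hn1 : γ.den < (n + 1) * γ.num.toNat := by
    rw [div_lt_iff₀ (by positivity)] at h1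
    have : (γ.den : ℚ) < ((n + 1) * γ.num.toNat : ℕ) := by
      push_cast
      rw [hnum]
      nlinarith
    exact_mod_cast this
  have hn2 : n * γ.num.toNat < γ.den := by
    rcases Nat.eq_zero_or_pos n with rfl | hn
    · simpa using γ.pos
    rw [lt_div_iff₀ (by exact_mod_cast hn)] at h2
    have : ((n * γ.num.toNat : ℕ) : ℚ) < γ.den := by
      push_cast
      rw [hnum]
      nlinarith
    exact_mod_cast this
  obtain ⟨hz, ho, hl⟩ := hlow.getD_of_slope hn1 hn2
  have hwne : V' ++ U' ≠ [] := by
    rw [← List.length_pos_iff, hup.length]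
    exact Rat.pos _
  have hcop : (mediant a c).num.toNat.Coprime (mediant a c).den := by
    have := (mediant a c).reduced
    rwa [show (mediant a c).num.natAbs = (mediant a c).num.toNat by omega] at this
  refine ⟨n, (mediant a c).num.toNat, (mediant a c).den, u, _, hlow, hz, ho,
    hlow.length ▸ hl, by omega, by omega, hcop, ?_, hs, ht⟩
  rw [← hup.per_eq, ← per_substWord hlow.ne_nil hwne]
  simp [substWord]

end BetaHoles

theorem mainTheorem7 (β : ℝ) (hβ₁ : 1 < β) (hβ₂ : β < 2)
    (γ γ₁ : ℚ) (hγ : ∀ n : ℕ, γ ≠ 1 / (n : ℚ)) (hγ₁ : BetaHoles.IsLeftFareyParent γ₁ γ)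
    (s t : BetaHoles.Word) (hst : BetaHoles.IsFareyTreePair γ s t)
    (hadm : BetaHoles.per s ∈ BetaHoles.admissibleSeqs β) :
    BetaHoles.IsMaximalExtremalPair β s t ↔
      BetaHoles.gammaOf β ∈ Set.Ico (γ₁ : ℝ) (γ : ℝ) := by
  open BetaHoles in
  obtain ⟨n, P, Q, u, w, h⟩ := hst.exists_isTreePair
  obtain ⟨U, c, V, hF, hmed⟩ := hγ₁
  obtain ⟨hU, hV, hdet⟩ := hF.isUpperWord
  obtain ⟨hnum, hden⟩ := mediant_num_den hdet
  rw [← hmed] at hnum hden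
  have hbal : IsBalancedWord γ (V ++ U) := ⟨_, _, _, _, hF, hmed, rfl⟩
  obtain ⟨hup, hp0, hpq⟩ := IsFareyWord.isUpperWord hbal
  have hdpos := γ.pos
  have hpar : (γ₁ : ℝ) ≤ gammaOf β := by
    rcases hF.left_eq_zero_or_isFareyWord with rfl | hbal₁
    -- if the left parent is `0`, then `γ` is of the form `1/n`
    · exfalso
      have hc1 : γ.num = 1 := by
        simp only [Rat.num_zero, Rat.den_zero, zero_mul, zero_add] at hnum hdet
        simpa [hnum] using hdet
      refine hγ γ.den ?_
      rw [← Rat.num_div_den γ, hc1]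
      simp
    · refine le_gammaOf hbal₁ (hU.mem_admissibleSeqs ?_)
      have h1 := hU.num_nonneg
      have h2 := hU.num_le
      have h3 := c.pos
      obtain ⟨k, hk⟩ := h.exists_lt_shift (p₁ := γ₁.num.toNat) (q₁ := γ₁.den) (by
        zify
        rw [Int.toNat_of_nonneg h1, Int.toNat_of_nonneg hp0.le, hnum, hden]
        push_cast
        linarith) γ₁.pos (by omega) (by omega)
      rw [hU.per_eq]
      exact hk.le.trans (hadm k)
  constructor
  · intro hmax
    refine ⟨hpar, ?_⟩
    by_contra! hge
    have hle : per (V ++ U) ≤ quasiGreedyOne β := by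
      by_contra! hlt
      exact (gammaOf_lt hbal hlt).not_ge hge
    refine hmax.no_orbit_right ⟨_, hup.mem_admissibleSeqs hle, ?_, fun k => ?_⟩
    · intro h0
      have h1 : ofLex (per (V ++ U)) 0 = 1 := by
        rw [hup.per_eq, mech_head_eq_one_iff (by omega)]
        omega
      rw [h0] at h1
      exact absurd h1 (by decide)
    · rw [hup.per_eq, shift_mech hdpos]
      exact h.per_t_lt.trans_le (mech_mono (by omega) (Nat.zero_le _) (Nat.mod_lt _ hdpos))
  · rintro ⟨-, hlt⟩
    have hlow : quasiGreedyOne β < per (V ++ U) := not_le.1 fun hle =>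
      (le_gammaOf hbal (hup.mem_admissibleSeqs hle)).not_gt hlt
    refine ⟨h.isExtremalPair, hadm, ?_, ?_, fun s' t' hext _ => h.hole_maximal hext⟩
    · rintro ⟨x, -, hx0, hx⟩
      -- a non-zero sequence has a tail beginning with `1`, and `s` begins with `0`
      refine hx0 (seq_ext fun k => (fin2_cases _).resolve_right fun h1 => ?_)
      refine (hx k).not_gt (lt_iff_exists.2 ⟨0, fun j hj => absurd hj (Nat.not_lt_zero j), ?_, ?_⟩)
      · exact h.per_s_zero (Nat.zero_le n)
      · rw [ofLex_shift, zero_add, h1]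
    · rintro ⟨x, hx, -, hxt⟩
      refine h.lower.not_forall_shift_between
        (fun k => h.pre_zeroSeq_le_per_t.trans (hxt k).le) fun k => ?_
      rw [← hup.per_eq]
      exact (hx k).trans_lt hlow
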